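/- Let $N\ge 3$, $\mathcal A=\{1,\dots,N\}$ (actors), $\mathcal O=\{-1,+1\}$ (opinions), and let $\mathcal S=\{u\in\mathbb Z^{\mathcal A}:\ \min_{a}|u(a)|=0\}$ be the set of lists of social pressures. For $a\in\mathcal A$, $o\in\mathcal O$ and $u\in\mathcal S$ let $\pi^{a,o}(u)\in\mathcal S$ be given by $\pi^{a,o}(u)(a)=0$ and $\pi^{a,o}(u)(b)=u(b)+o$ for $b\ne a$. For $\beta\ge 0$ and $u\in\mathcal S$ let $(U^{\beta,u}_t)_{t\ge 0}$ be the Markov jump process on $\mathcal S$ started at $u$ which, when at $v$, jumps to $\pi^{a,o}(v)$ at rate $e^{\beta o v(a)}$ for each $(a,o)\in\mathcal A\times\mathcal O$; that is, at $v$ independent exponential clocks with parameters $e^{\beta o v(a)}$ are attached to the pairs $(a,o)$, the pair $(a,o)$ whose clock rings first moves the process at that time from $v$ to $\pi^{a,o}(v)$, new independent clocks are then attached at $\pi^{a,o}(v)$, and so on. Let $$\mathcal L=\{u\in\mathcal S:\{u(1),\dots,u(N)\}=\{0,1,\dots,N-1\}\}\cup\{u\in\mathcal S:\{u(1),\dots,u(N)\}=\{0,-1,\dots,-(N-1)\}\}$$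 be the set of ladder lists, and for $B\subset\mathcal S$ let $R^{\beta,u}(B)=\inf\{t>0:U^{\beta,u}_t\in B\}$ (with $\inf\emptyset=\infty$). Then: (1) There is a constant $C>0$ (which may depend on $N$) such that for every $\beta\ge 0$ the process has a unique invariant probability measure $\mu^\beta$, and $$\mu^\beta(\mathcal L)\ \ge\ 1-C e^{-\beta}.$$ (2) For every fixed $\delta>0$, $$\sup_{u\in\mathcal S\setminus\{\vec 0\}}\mathbb P\big(R^{\beta,u}(\mathcal L)>e^{-\beta(1-\delta)}\big)\ \longrightarrow\ 0\qquad\text{as }\beta\to+\infty,$$ where $\vec 0$ denotes the null list. -/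

import Mathlib

/-!
A social network of `N` actors. The list of social pressures `u` is an integer vector with at least
one null coordinate. Actor `a` expresses opinion `o` at rate `exp (β * o * u a)`; when this happens
the pressure on `a` is reset to `0` and the pressure on every other actor is increased by `o`.
-/

open MeasureTheory ProbabilityTheory Filter Topology

noncomputable section

namespace SocialNetwork

/-- The set `𝒮` of lists of social pressures: integer vectors with `min_a |u a| = 0`, that is, with
at least one null coordinate. The opinions `-1`, `+1` are the elements of `ℤˣ`. -/
abbrev PressureList (N : ℕ) : Type := {u : Fin N → ℤ // ∃ a, u a = 0}

variable {N : ℕ}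

/-- The list obtained from `u` when actor `a` expresses opinion `o`. -/
def express (a : Fin N) (o : ℤˣ) (u : PressureList N) : PressureList N :=
  ⟨fun b => if b = a then 0 else u.1 b + (o : ℤ), a, by simp⟩

/-- An index at which a real-valued function on a nonempty finite type is minimal. -/
def argMin {ι : Type*} [Finite ι] [Nonempty ι] (f : ι → ℝ) : ι :=
  Classical.choose (Finite.exists_min f)

theorem argMin_le {ι : Type*} [Finite ι] [Nonempty ι] (f : ι → ℝ) (i : ι) :
    f (argMin f) ≤ f i :=
  Classical.choose_spec (Finite.exists_min f) i

/-- The randomness: at each step, one real number for each pair (actor, opinion). -/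
abbrev Sample (N : ℕ) : Type := ℕ → Fin N × ℤˣ → ℝ

instance instIsProbabilityMeasureExpOne : IsProbabilityMeasure (expMeasure 1) :=
  isProbabilityMeasure_expMeasure one_pos

/-- The law under which all the coordinates of a sample are independent exponential random
variables of parameter `1`. -/
def prob (N : ℕ) : Measure (Sample N) :=
  Measure.infinitePi fun _ : ℕ => Measure.pi fun _ : Fin N × ℤˣ => expMeasure 1

/-- The clocks associated to the list `u`. If the `e i` are independent exponential variables of
parameter `1`, the clock of `(a, o)` is exponential of parameter `exp (β * o * u a)`, and the clocks
are independent. -/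
def clock (β : ℝ) (u : PressureList N) (e : Fin N × ℤˣ → ℝ) (i : Fin N × ℤˣ) : ℝ :=
  e i / Real.exp (β * ((i.2 : ℤ) : ℝ) * (u.1 i.1 : ℝ))

theorem nonempty_pairs (u : PressureList N) : Nonempty (Fin N × ℤˣ) :=
  u.2.elim fun a _ => ⟨(a, 1)⟩

/-- The pair (actor, opinion) whose clock rings first. -/
def firstRing (β : ℝ) (u : PressureList N) (e : Fin N × ℤˣ → ℝ) : Fin N × ℤˣ :=
  haveI := nonempty_pairs u
  argMin (clock β u e)

/-- The embedded chain: the list after the first `n` expressed opinions, starting from `u`. -/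
def chain (β : ℝ) (u : PressureList N) (ω : Sample N) : ℕ → PressureList N
  | 0 => u
  | n + 1 =>
    let v := chain β u ω n
    express (firstRing β v (ω n)).1 (firstRing β v (ω n)).2 v

/-- The time `T_n` of the `n`-th expressed opinion, with `T_0 = 0`. -/
def jumpTime (β : ℝ) (u : PressureList N) (ω : Sample N) : ℕ → ℝ
  | 0 => 0
  | n + 1 =>
    let v := chain β u ω n
    jumpTime β u ω n + clock β v (ω n) (firstRing β v (ω n))

open Classical in
/-- The system of social pressures at time `t`, started at `u`: it is the list after `m` expressed
opinions if `T_m ≤ t < T_{m+1}`, and `none` (undefined) if there is no such `m`. -/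
def process (β : ℝ) (u : PressureList N) (ω : Sample N) (t : ℝ) : Option (PressureList N) :=
  if h : ∃ m : ℕ, jumpTime β u ω m ≤ t ∧ t < jumpTime β u ω (m + 1) then
    some (chain β u ω (Nat.find h))
  else none

/-- The reaching time `inf {t > 0 : U_t ∈ B}`, equal to `∞` if `B` is never reached. -/
def reachTime (β : ℝ) (u : PressureList N) (B : Set (PressureList N)) (ω : Sample N) : ENNReal :=
  sInf {r : ENNReal | ∃ t : ℝ, 0 < t ∧ (∃ v ∈ B, process β u ω t = some v) ∧ r = ENNReal.ofReal t}

/-- The transition probability `ℙ(U_t ∈ B)` of the process started at `u`. -/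
def transProb (β t : ℝ) (u : PressureList N) (B : Set (PressureList N)) : ENNReal :=
  prob N {ω | ∃ v ∈ B, process β u ω t = some v}

/-- `μ` is an invariant probability measure of the process with polarization coefficient `β`. -/
def IsInvariantProb (β : ℝ) (μ : Measure (PressureList N)) : Prop :=
  IsProbabilityMeasure μ ∧
    ∀ t : ℝ, 0 ≤ t → ∀ B : Set (PressureList N), ∫⁻ u, transProb β t u B ∂μ = μ B

/-- The positive ladder lists: those with set of values `{0, 1, ..., N - 1}`. -/
def posLadder (N : ℕ) : Set (PressureList N) :=
  {u | Set.range u.1 = Set.Ico 0 (N : ℤ)}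

/-- The negative ladder lists: those with set of values `{0, -1, ..., -(N - 1)}`. -/
def negLadder (N : ℕ) : Set (PressureList N) :=
  {u | Set.range u.1 = Set.Ioc (-(N : ℤ)) 0}

/-- The ladder lists. -/
def ladder (N : ℕ) : Set (PressureList N) :=
  posLadder N ∪ negLadder N

end SocialNetwork

end

/-!
The *cost* of expressing the opinion `o` of the actor `a` at the list `u` is
`peak u - o * u a`, where `peak u` is the largest absolute pressure. At `u` the pair `(a, o)` rings
first with probability at most `exp (-β * cost)`, and only pairs of cost zero matter for large `β`.

*Combinatorics.* A path of `3 * N` steps of cost zero ends at a ladder list, from any starting list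
(`run_mem_ladder`): `N` steps reset every large pressure, `N` more steps remove the smaller of the
positive and the negative part, and `N` more steps sort the list. Conversely a one-signed list with
distinct values keeps these properties along a path of cost less than `N - 1`. A long cheap path
contains `3 * N` successive steps of cost zero, so a path of `3 * N * N` steps which ends at a list
`v` outside the ladder costs at least `N - peak v` (`sub_peak_le_pathCost`). The delicate case is
that of the null list: the last step of the path costs at least `1` and comes, as `N ≥ 3`, from a
list with a repeated value.

*The invariant measure.* The embedded chain satisfies a Doeblin condition in `2 * N` steps, so it
has a stationary law `ν`, and `μ u ∝ ν u / totalRate β u`. By the cost estimate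
`ν v ≤ c * exp (-β * (N - peak v))` outside the ladder, while
`totalRate β v ≥ exp (β * peak v)`: the complement of the ladder has an unnormalized mass of order
at most `exp (-β * N)`. The ladder has a `ν`-mass bounded below and rates of order at most
`exp (β * (N - 1))`, hence an unnormalized mass of order at least `exp (-β * (N - 1))`
(`exists_compl_le_mul_ladder`).

*The semigroup.* That `μ` is invariant for the transition probabilities of the process comes from
the renewal equation at the first jump (`transProb_renewal`), convolved with the function `1` so as
to give an integrated backward equation (`transProb_backward`); summed against `μ`, its two integral
terms cancel since `ν` is stationary. Nonexplosion is not needed beforehand. Uniqueness follows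
from a lower bound, uniform in `u`, of the probability of being at a given list at time `1`
(`exists_le_transProb_one`, `eq_of_invariant`).

*The reaching time.* If at each of the first `3 * N` steps no exponential variable is smaller than
another one by a factor `exp (-β)`, all the steps have cost zero whatever the lists are. Starting
from a list which is not null the process then reaches the ladder after `3 * N` jumps, and since no
list on the way is null the rate of each of these jumps is at least `exp β` (`reachTime_le`).
-/

noncomputable section

namespace SocialNetwork

variable {N : ℕ}

/-! ### Paths of expressed opinions and their costs -/

/-- The largest absolute value of a social pressure. -/
def peak (u : PressureList N) : ℕ :=
  Finset.univ.sup fun a => (u.1 a).natAbs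

theorem abs_le_peak (u : PressureList N) (a : Fin N) : |u.1 a| ≤ peak u := by
  have : (u.1 a).natAbs ≤ peak u :=
    Finset.le_sup (f := fun a => (u.1 a).natAbs) (Finset.mem_univ a)
  rw [Int.abs_eq_natAbs]
  exact_mod_cast this

theorem exists_abs_eq_peak (u : PressureList N) : ∃ a, |u.1 a| = peak u := by
  obtain ⟨a₀, -⟩ := u.2
  obtain ⟨a, -, ha⟩ := Finset.exists_mem_eq_sup Finset.univ ⟨a₀, Finset.mem_univ _⟩
    fun a => (u.1 a).natAbs
  exact ⟨a, by rw [Int.abs_eq_natAbs, peak, ha]⟩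

theorem units_cases (o : ℤˣ) : (o : ℤ) = 1 ∨ (o : ℤ) = -1 := by
  rcases Int.units_eq_one_or o with rfl | rfl <;> simp

theorem units_mul_le_peak (u : PressureList N) (o : ℤˣ) (a : Fin N) : (o : ℤ) * u.1 a ≤ peak u := by
  have h := abs_le.1 (abs_le_peak u a)
  rcases units_cases o with h' | h' <;> rw [h'] <;> omega

/-- The cost of the pair `(a, o)` at the list `u`: it is expressed first with a probability of order
at most `exp (-β * stepCost u (a, o))`. -/
def stepCost (u : PressureList N) (i : Fin N × ℤˣ) : ℤ := peak u - (i.2 : ℤ) * u.1 i.1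

theorem stepCost_nonneg (u : PressureList N) (i : Fin N × ℤˣ) : 0 ≤ stepCost u i :=
  sub_nonneg.2 (units_mul_le_peak u i.2 i.1)

theorem exists_stepCost_eq_zero (u : PressureList N) : ∃ i, stepCost u i = 0 := by
  obtain ⟨a, ha⟩ := exists_abs_eq_peak u
  rcases le_total 0 (u.1 a) with h | h
  · exact ⟨(a, 1), by simp [stepCost, ← ha, abs_of_nonneg h]⟩
  · exact ⟨(a, -1), by simp [stepCost, ← ha, abs_of_nonpos h]⟩

/-- The list obtained from `u` when a finite sequence of opinions is expressed. -/
def run : PressureList N → List (Fin N × ℤˣ) → PressureList N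
  | u, [] => u
  | u, i :: l => run (express i.1 i.2 u) l

/-- The total cost of a finite sequence of expressed opinions. -/
def pathCost : PressureList N → List (Fin N × ℤˣ) → ℤ
  | _, [] => 0
  | u, i :: l => stepCost u i + pathCost (express i.1 i.2 u) l

theorem pathCost_nonneg (u : PressureList N) (l : List (Fin N × ℤˣ)) : 0 ≤ pathCost u l := by
  induction l generalizing u with
  | nil => exact le_rfl
  | cons i l ih => exact add_nonneg (stepCost_nonneg u i) (ih _)

theorem run_append (u : PressureList N) (l l' : List (Fin N × ℤˣ)) :
    run u (l ++ l') = run (run u l) l' := by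
  induction l generalizing u with
  | nil => rfl
  | cons i l ih => exact ih _

theorem pathCost_append (u : PressureList N) (l l' : List (Fin N × ℤˣ)) :
    pathCost u (l ++ l') = pathCost u l + pathCost (run u l) l' := by
  induction l generalizing u with
  | nil => simp [pathCost, run]
  | cons i l ih => simp only [List.cons_append, pathCost, run, ih, add_assoc]

theorem express_self (a : Fin N) (o : ℤˣ) (u : PressureList N) : (express a o u).1 a = 0 := by
  simp [express]

theorem express_ne {a b : Fin N} (h : b ≠ a) (o : ℤˣ) (u : PressureList N) :
    (express a o u).1 b = u.1 b + o := by
  simp [express, h]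

theorem exists_run_pathCost_eq_zero (n : ℕ) (u : PressureList N) :
    ∃ l : List (Fin N × ℤˣ), l.length = n ∧ pathCost u l = 0 := by
  induction n generalizing u with
  | zero => exact ⟨[], rfl, rfl⟩
  | succ n ih =>
    obtain ⟨i, hi⟩ := exists_stepCost_eq_zero u
    obtain ⟨l, hl, hc⟩ := ih (express i.1 i.2 u)
    exact ⟨i :: l, by simp [hl], by simp [pathCost, hi, hc]⟩

/-- Properties propagated by the steps of cost zero are propagated along paths of cost zero. -/
theorem run_of_pathCost_eq_zero {P : ℕ → PressureList N → Prop}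
    (step : ∀ k u i, P k u → stepCost u i = 0 → P (k + 1) (express i.1 i.2 u))
    (l : List (Fin N × ℤˣ)) {k : ℕ} {u : PressureList N} (h : P k u) (hl : pathCost u l = 0) :
    P (k + l.length) (run u l) := by
  induction l generalizing k u with
  | nil => exact h
  | cons i l ih =>
    have h1 := stepCost_nonneg u i
    have h2 := pathCost_nonneg (express i.1 i.2 u) l
    simp only [pathCost] at hl
    have := ih (step k u i h (by omega)) (by omega)
    simpa only [List.length_cons, run, add_assoc, add_comm 1] using this

/-! ### Paths of cost zero reach the ladder lists -/

theorem card_filter_lt_abs_express (k : ℕ) (u : PressureList N) (i : Fin N × ℤˣ)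
    (h : (Finset.univ.filter fun a => (k : ℤ) < |u.1 a|).card ≤ N - k) (hi : stepCost u i = 0) :
    (Finset.univ.filter fun a => ((k + 1 : ℕ) : ℤ) < |(express i.1 i.2 u).1 a|).card ≤
      N - (k + 1) := by
  have hsub : (Finset.univ.filter fun a => ((k + 1 : ℕ) : ℤ) < |(express i.1 i.2 u).1 a|) ⊆
      (Finset.univ.filter fun a => (k : ℤ) < |u.1 a|).erase i.1 := by
    intro b hb
    simp only [Finset.mem_filter, Finset.mem_univ, true_and, Finset.mem_erase] at hb ⊢
    by_cases hba : b = i.1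
    · subst hba
      rw [express_self, abs_zero] at hb
      push_cast at hb; omega
    · refine ⟨hba, ?_⟩
      rw [express_ne hba] at hb
      have := abs_add_le (u.1 b) (i.2 : ℤ)
      have h1 : |(i.2 : ℤ)| = 1 := by rcases units_cases i.2 with h | h <;> rw [h] <;> rfl
      push_cast at hb; omega
  by_cases hk : (k : ℤ) < peak u
  · have hmem : i.1 ∈ Finset.univ.filter fun a => (k : ℤ) < |u.1 a| := by
      simp only [Finset.mem_filter, Finset.mem_univ, true_and]
      have h1 : (i.2 : ℤ) * u.1 i.1 = peak u := by simp only [stepCost] at hi; omega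
      rcases units_cases i.2 with h | h <;> rw [h] at h1 <;> rw [lt_abs] <;> omega
    have := Finset.card_le_card hsub
    rw [Finset.card_erase_of_mem hmem] at this
    omega
  · have hempty : (Finset.univ.filter fun a => (k : ℤ) < |u.1 a|) = ∅ := by
      refine Finset.filter_eq_empty_iff.2 fun a _ => ?_
      have := abs_le_peak u a
      omega
    rw [hempty] at hsub
    rw [Finset.subset_empty.1 (hsub.trans (Finset.erase_subset _ _))]
    simp

/-- After `N` steps of cost zero all the pressures are at most `N` in absolute value: as long as
some pressure is large, each step resets one of the large ones. -/
theorem abs_le_of_pathCost_eq_zero (u : PressureList N) (l : List (Fin N × ℤˣ))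
    (hl : l.length = N) (hc : pathCost u l = 0) (a : Fin N) : |(run u l).1 a| ≤ N := by
  have h := run_of_pathCost_eq_zero
    (P := fun k u => (Finset.univ.filter fun a => (k : ℤ) < |u.1 a|).card ≤ N - k)
    card_filter_lt_abs_express l (k := 0) (u := u)
    (by simpa using Finset.card_le_univ (Finset.univ.filter fun a => 0 < |u.1 a|)) hc
  rw [hl] at h
  simp only [zero_add, le_refl, Nat.sub_eq_zero_of_le, Nat.le_zero, Finset.card_eq_zero,
    Finset.filter_eq_empty_iff, Finset.mem_univ, true_imp_iff, not_lt] at h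
  exact @h a

/-- In a step of cost zero, the smaller of the two parts (positive and negative) of the list
decreases. -/
theorem neg_le_express {u : PressureList N} {σ : ℤˣ} {m : ℕ}
    (h : ∀ a, -(m : ℤ) ≤ (σ : ℤ) * u.1 a) {i : Fin N × ℤˣ} (hi : stepCost u i = 0) (b : Fin N) :
    -((m - 1 : ℕ) : ℤ) ≤ (i.2 : ℤ) * (express i.1 i.2 u).1 b := by
  by_cases hb : b = i.1
  · subst hb; rw [express_self]; simp
  · rw [express_ne hb]
    have h1 := abs_le.1 (abs_le_peak u b)
    have h2 := h b
    have h3 := h i.1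
    simp only [stepCost] at hi
    rcases units_cases i.2 with h' | h' <;> rcases units_cases σ with h'' | h'' <;>
      rw [h'] at hi ⊢ <;> rw [h''] at h2 h3 <;> omega

theorem exists_sign_of_pathCost_eq_zero (u : PressureList N) (hu : ∀ a, |u.1 a| ≤ N)
    (l : List (Fin N × ℤˣ)) (hl : l.length = N) (hc : pathCost u l = 0) :
    ∃ σ : ℤˣ, ∀ a, 0 ≤ (σ : ℤ) * (run u l).1 a := by
  have h := run_of_pathCost_eq_zero
    (P := fun k u => ∃ σ : ℤˣ, ∀ a, -((N - k : ℕ) : ℤ) ≤ (σ : ℤ) * u.1 a)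
    (fun k u i ⟨σ, hσ⟩ hi => ⟨i.2, fun b => by
      simpa only [Nat.sub_sub] using neg_le_express hσ hi b⟩) l (k := 0) (u := u)
    ⟨1, fun a => by have := abs_le.1 (hu a); simp; omega⟩ hc
  simpa [hl] using h

/-- The invariant behind the convergence to the ladder lists: up to the sign `σ` the list is
nonnegative, the values smaller than `k` are taken once, and at most `N - k` actors have a value at
least `k`. -/
def Sorted (k : ℕ) (u : PressureList N) : Prop :=
  ∃ σ : ℤˣ, (∀ a, 0 ≤ (σ : ℤ) * u.1 a) ∧ Set.InjOn u.1 {a | (σ : ℤ) * u.1 a < k} ∧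
    (Finset.univ.filter fun a => (k : ℤ) ≤ (σ : ℤ) * u.1 a).card ≤ N - k

theorem Sorted.express (hN : 2 ≤ N) {k : ℕ} {u : PressureList N} {i : Fin N × ℤˣ}
    (h : Sorted k u) (hi : stepCost u i = 0) : Sorted (k + 1) (express i.1 i.2 u) := by
  have key : (∀ a, 0 ≤ (i.2 : ℤ) * u.1 a) ∧ Set.InjOn u.1 {a | (i.2 : ℤ) * u.1 a < k} ∧
    (Finset.univ.filter fun a => (k : ℤ) ≤ (i.2 : ℤ) * u.1 a).card ≤ N - k := by
    obtain ⟨σ, h1, h2, h3⟩ := h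
    by_cases hσ : σ = i.2
    · rw [← hσ]; exact ⟨h1, h2, h3⟩
    · -- the opinion opposite to the sign of the list has cost zero at the null list only
      have hz : ∀ a, u.1 a = 0 := by
        intro a
        have h4 := abs_le.1 (abs_le_peak u a)
        have h5 := h1 a
        have h6 := h1 i.1
        simp only [stepCost] at hi
        have h7 : (σ : ℤ) = -(i.2 : ℤ) := by
          rw [← Units.val_neg, Int.units_ne_iff_eq_neg.1 hσ]
        rw [h7] at h5 h6
        rcases units_cases i.2 with h' | h' <;> rw [h'] at h5 h6 hi <;> omega
      rcases Nat.eq_zero_or_pos k with rfl | hk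
      · refine ⟨fun a => by simp [hz], fun a ha => ?_,
          (Finset.card_le_univ _).trans (by simp)⟩
        simp [hz] at ha
      · exfalso
        have := @h2 ⟨0, by omega⟩ (by simpa [hz] using hk) ⟨1, by omega⟩
          (by simpa [hz] using hk) (by simp [hz])
        simp at this
  clear h
  obtain ⟨h1, h2, h3⟩ := key
  have hval : ∀ b, b ≠ i.1 →
      (i.2 : ℤ) * (SocialNetwork.express i.1 i.2 u).1 b = (i.2 : ℤ) * u.1 b + 1 := by
    intro b hb
    rw [express_ne hb]
    rcases units_cases i.2 with h' | h' <;> rw [h'] <;> ring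
  have hself := express_self i.1 i.2 u
  refine ⟨i.2, fun a => ?_, fun a ha b hb hab => ?_, ?_⟩
  · by_cases ha : a = i.1
    · rw [ha, hself]; simp
    · rw [hval a ha]; have := h1 a; omega
  · have hab' := congrArg (fun x => (i.2 : ℤ) * x) hab
    simp only [Set.mem_ofPred_eq] at ha hb hab'
    have ha1 := h1 a
    have hb1 := h1 b
    by_cases haa : a = i.1 <;> by_cases hbb : b = i.1
    · rw [haa, hbb]
    · rw [haa, hself, hval b hbb] at hab'; omega
    · rw [hbb, hself, hval a haa] at hab'; omega
    · rw [hval a haa] at ha hab'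
      rw [hval b hbb] at hb hab'
      refine @h2 a (by simp only [Set.mem_ofPred_eq]; push_cast at ha; omega) b
        (by simp only [Set.mem_ofPred_eq]; push_cast at hb; omega) ?_
      rw [express_ne haa, express_ne hbb] at hab
      omega
  · have hsub : (Finset.univ.filter fun a => ((k + 1 : ℕ) : ℤ) ≤
        (i.2 : ℤ) * (SocialNetwork.express i.1 i.2 u).1 a) ⊆
        (Finset.univ.filter fun a => (k : ℤ) ≤ (i.2 : ℤ) * u.1 a).erase i.1 := by
      intro b hb
      simp only [Finset.mem_filter, Finset.mem_univ, true_and, Finset.mem_erase] at hb ⊢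
      by_cases hba : b = i.1
      · rw [hba, hself] at hb; push_cast at hb; omega
      · rw [hval b hba] at hb; push_cast at hb; exact ⟨hba, by omega⟩
    by_cases hk : (k : ℤ) ≤ (i.2 : ℤ) * u.1 i.1
    · have := Finset.card_le_card hsub
      rw [Finset.card_erase_of_mem (by simpa using hk)] at this
      omega
    · have hempty : (Finset.univ.filter fun a => (k : ℤ) ≤ (i.2 : ℤ) * u.1 a) = ∅ := by
        refine Finset.filter_eq_empty_iff.2 fun a _ => ?_
        have := units_mul_le_peak u i.2 a
        simp only [stepCost] at hi
        omega
      rw [hempty] at hsub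
      rw [Finset.subset_empty.1 (hsub.trans (Finset.erase_subset _ _))]
      simp

/-- A one-signed list with pairwise distinct values. -/
def Settled (u : PressureList N) : Prop :=
  (∃ σ : ℤˣ, ∀ a, 0 ≤ (σ : ℤ) * u.1 a) ∧ Function.Injective u.1

theorem mem_ladder_of_injective {u : PressureList N} {σ : ℤˣ} (h0 : ∀ a, 0 ≤ (σ : ℤ) * u.1 a)
    (hlt : ∀ a, (σ : ℤ) * u.1 a < N) (hinj : Function.Injective u.1) : u ∈ ladder N := by
  have key : ∀ s : Finset ℤ, s.card = N → (∀ a, u.1 a ∈ s) → Set.range u.1 = s := by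
    intro s hs hmem
    have : Finset.univ.image u.1 = s := by
      refine Finset.eq_of_subset_of_card_le (fun x hx => ?_) ?_
      · obtain ⟨a, -, rfl⟩ := Finset.mem_image.1 hx
        exact hmem a
      · rw [Finset.card_image_of_injective _ hinj, hs]; simp
    rw [← this]; simp
  rcases units_cases σ with h | h <;> rw [h] at h0 hlt
  · left
    have := key (Finset.Ico 0 (N : ℤ)) (by simp) fun a => by
      have := h0 a; have := hlt a; rw [Finset.mem_Ico]; omega
    simpa [posLadder] using this
  · right
    have := key (Finset.Ioc (-(N : ℤ)) 0) (by simp) fun a => by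
      have := h0 a; have := hlt a; rw [Finset.mem_Ioc]; omega
    simpa [negLadder] using this

theorem Sorted.mem_ladder {u : PressureList N} (h : Sorted N u) : u ∈ ladder N := by
  obtain ⟨σ, h1, h2, h3⟩ := h
  simp only [le_refl, Nat.sub_eq_zero_of_le, Nat.le_zero, Finset.card_eq_zero,
    Finset.filter_eq_empty_iff, Finset.mem_univ, true_imp_iff, not_le] at h3
  exact mem_ladder_of_injective h1 (fun a => @h3 a) fun a b hab => h2 (@h3 a) (@h3 b) hab

/-- A path of cost zero with `3 * N` steps leads to a ladder list, from any starting list. -/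
theorem run_mem_ladder (hN : 2 ≤ N) (u : PressureList N) (l : List (Fin N × ℤˣ))
    (hl : l.length = 3 * N) (hc : pathCost u l = 0) : run u l ∈ ladder N := by
  obtain ⟨l₁, l₂, l₃, rfl, h1, h2, h3⟩ : ∃ l₁ l₂ l₃ : List (Fin N × ℤˣ), l = l₁ ++ (l₂ ++ l₃) ∧
      l₁.length = N ∧ l₂.length = N ∧ l₃.length = N :=
    ⟨l.take N, (l.drop N).take N, (l.drop N).drop N, by simp,
      by simp; omega, by simp; omega, by simp; omega⟩
  rw [pathCost_append, pathCost_append] at hc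
  have c1 := pathCost_nonneg u l₁
  have c2 := pathCost_nonneg (run u l₁) l₂
  have c3 := pathCost_nonneg (run (run u l₁) l₂) l₃
  rw [run_append, run_append]
  obtain ⟨σ, hσ⟩ := exists_sign_of_pathCost_eq_zero (run u l₁)
    (abs_le_of_pathCost_eq_zero u l₁ h1 (by omega)) l₂ h2 (by omega)
  have := run_of_pathCost_eq_zero (P := Sorted) (fun k u i h hi => h.express hN hi) l₃ (k := 0)
    (u := run (run u l₁) l₂)
    ⟨σ, hσ, fun a ha => absurd (hσ a) (by simpa using ha),
      (Finset.card_le_univ _).trans (by simp)⟩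
    (by omega)
  rw [zero_add, h3] at this
  exact this.mem_ladder

theorem settled_of_mem_ladder {u : PressureList N} (h : u ∈ ladder N) : Settled u := by
  have key : ∀ s : Finset ℤ, s.card = N → Set.range u.1 = s → Function.Injective u.1 := by
    intro s hs hr
    have : Finset.univ.image u.1 = s := by rw [← Finset.coe_inj, ← hr]; simp
    rw [← Set.injOn_univ, ← Finset.coe_univ]
    exact Finset.card_image_iff.1 (by rw [this, hs]; simp)
  rcases h with h | h
  · refine ⟨⟨1, fun a => ?_⟩, key (Finset.Ico 0 (N : ℤ)) (by simp) (by rw [h.out]; simp)⟩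
    have : u.1 a ∈ Set.Ico 0 (N : ℤ) := h ▸ Set.mem_range_self a
    simpa using this.1
  · refine ⟨⟨-1, fun a => ?_⟩, key (Finset.Ioc (-(N : ℤ)) 0) (by simp) (by rw [h.out]; simp)⟩
    have : u.1 a ∈ Set.Ioc (-(N : ℤ)) 0 := h ▸ Set.mem_range_self a
    simpa using this.2

/-! ### The cost of leaving the ladder lists -/

theorem Settled.mem_ladder {u : PressureList N} (h : Settled u) (hp : peak u < N) :
    u ∈ ladder N := by
  obtain ⟨⟨σ, hσ⟩, hinj⟩ := h
  refine mem_ladder_of_injective hσ (fun a => ?_) hinj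
  have := units_mul_le_peak u σ a
  omega

theorem Settled.le_peak {u : PressureList N} (h : Settled u) : N ≤ peak u + 1 := by
  obtain ⟨⟨σ, hσ⟩, hinj⟩ := h
  have h1 : (Finset.univ.image fun a => (σ : ℤ) * u.1 a).card ≤
      (Finset.Icc 0 (peak u : ℤ)).card := by
    refine Finset.card_le_card fun x hx => ?_
    obtain ⟨a, -, rfl⟩ := Finset.mem_image.1 hx
    exact Finset.mem_Icc.2 ⟨hσ a, units_mul_le_peak u σ a⟩
  rw [Finset.card_image_of_injective _ fun a b hab => hinj (mul_left_cancel₀ σ.ne_zero hab)] at h1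
  simpa using h1

/-- An opinion opposite to the sign of a settled list is expensive, the other ones lead to a
settled list. -/
theorem Settled.express {u : PressureList N} (h : Settled u) {i : Fin N × ℤˣ}
    (hi : stepCost u i + 2 ≤ N) : Settled (express i.1 i.2 u) := by
  have hp := h.le_peak
  obtain ⟨⟨σ, hσ⟩, hinj⟩ := h
  obtain rfl : σ = i.2 := by
    by_contra hne
    have h1 : (σ : ℤ) = -(i.2 : ℤ) := by
      rw [← Units.val_neg, Int.units_ne_iff_eq_neg.1 hne]
    have h2 := hσ i.1
    rw [h1, neg_mul] at h2
    simp only [stepCost] at hi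
    omega
  have hval : ∀ b, b ≠ i.1 →
      (i.2 : ℤ) * (SocialNetwork.express i.1 i.2 u).1 b = (i.2 : ℤ) * u.1 b + 1 := by
    intro b hb
    rw [express_ne hb]
    rcases units_cases i.2 with h' | h' <;> rw [h'] <;> ring
  have hself := express_self i.1 i.2 u
  refine ⟨⟨i.2, fun a => ?_⟩, fun a b hab => ?_⟩
  · by_cases ha : a = i.1
    · rw [ha, hself]; simp
    · rw [hval a ha]; have := hσ a; omega
  · have hab' : (i.2 : ℤ) * (SocialNetwork.express i.1 i.2 u).1 a =
        (i.2 : ℤ) * (SocialNetwork.express i.1 i.2 u).1 b := by rw [hab]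
    have ha1 := hσ a
    have hb1 := hσ b
    by_cases haa : a = i.1 <;> by_cases hbb : b = i.1
    · rw [haa, hbb]
    · rw [haa, hself, hval b hbb] at hab'; omega
    · rw [hbb, hself, hval a haa] at hab'; omega
    · rw [express_ne haa, express_ne hbb] at hab
      exact hinj (by omega)

theorem Settled.run {u : PressureList N} (h : Settled u) (l : List (Fin N × ℤˣ))
    (hl : pathCost u l + 2 ≤ N) : Settled (run u l) := by
  induction l generalizing u with
  | nil => exact h
  | cons i l ih =>
    have h1 := stepCost_nonneg u i
    have h2 := pathCost_nonneg (SocialNetwork.express i.1 i.2 u) l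
    simp only [pathCost] at hl
    exact ih (h.express (by omega)) (by omega)

/-- A long cheap path contains `3 * N` successive steps of cost zero, hence it visits a ladder list;
after that visit it is too cheap to unsettle the list. -/
theorem settled_run_of_length (hN : 2 ≤ N) (k : ℕ) (hk : k + 2 ≤ N) (u : PressureList N)
    (l : List (Fin N × ℤˣ)) (hl : (k + 1) * (3 * N) ≤ l.length) (hc : pathCost u l ≤ k) :
    Settled (run u l) := by
  induction k generalizing u l with
  | zero =>
    rw [← List.take_append_drop (3 * N) l, pathCost_append] at hc
    rw [← List.take_append_drop (3 * N) l, run_append]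
    have h1 := pathCost_nonneg u (l.take (3 * N))
    have h2 := pathCost_nonneg (SocialNetwork.run u (l.take (3 * N))) (l.drop (3 * N))
    push_cast at hc
    exact (settled_of_mem_ladder (run_mem_ladder hN u _ (by simp; omega) (by omega))).run _
      (by omega)
  | succ k ih =>
    rw [← List.take_append_drop (3 * N) l, pathCost_append] at hc
    rw [← List.take_append_drop (3 * N) l, run_append]
    have h1 := pathCost_nonneg u (l.take (3 * N))
    have h2 := pathCost_nonneg (SocialNetwork.run u (l.take (3 * N))) (l.drop (3 * N))
    push_cast at hc
    have hl' : (k + 1) * (3 * N) + 3 * N ≤ l.length := by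
      calc _ = (k + 1 + 1) * (3 * N) := by ring
        _ ≤ _ := hl
    rcases h1.eq_or_lt with h0 | h0
    · exact (settled_of_mem_ladder (run_mem_ladder hN u _ (by simp; omega) h0.symm)).run _
        (by omega)
    · exact ih (by omega) _ _ (by simp; omega) (by omega)

/-- The null list can only be reached from a list of the form `±(0, 1, ..., 1)`. -/
theorem of_express_eq_zero (hN : 3 ≤ N) {u : PressureList N} {i : Fin N × ℤˣ}
    (h : (express i.1 i.2 u).1 = 0) : 1 ≤ stepCost u i ∧ ¬ Settled u := by
  have hval : ∀ b, b ≠ i.1 → u.1 b = -(i.2 : ℤ) := by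
    intro b hb
    have := congrFun h b
    rw [express_ne hb, Pi.zero_apply] at this
    omega
  obtain ⟨b, c, hb, hc, hbc⟩ : ∃ b c : Fin N, b ≠ i.1 ∧ c ≠ i.1 ∧ b ≠ c := by
    have : 1 < (Finset.univ.erase i.1).card := by
      rw [Finset.card_erase_of_mem (Finset.mem_univ _)]; simp; omega
    obtain ⟨b, hb, c, hc, hbc⟩ := Finset.one_lt_card.1 this
    exact ⟨b, c, Finset.ne_of_mem_erase hb, Finset.ne_of_mem_erase hc, hbc⟩
  refine ⟨?_, fun hs => hbc (hs.2 (by rw [hval b hb, hval c hc]))⟩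
  obtain ⟨a, ha⟩ := u.2
  have hia : u.1 i.1 = 0 := by
    by_cases hai : a = i.1
    · rwa [← hai]
    · rw [hval a hai] at ha
      rcases units_cases i.2 with h' | h' <;> rw [h'] at ha <;> omega
  have h1 := abs_le.1 (abs_le_peak u b)
  rw [hval b hb] at h1
  simp only [stepCost, hia, mul_zero, sub_zero]
  rcases units_cases i.2 with h' | h' <;> rw [h'] at h1 <;> omega

theorem eq_zero_of_peak_eq_zero {u : PressureList N} (h : peak u = 0) : u.1 = 0 := by
  ext a
  have := abs_le_peak u a
  simpa [h] using this

/-- A path with `3 * N * N` steps that ends at a list which is not a ladder list has a cost at least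
`N` minus the peak of that list. -/
theorem sub_peak_le_pathCost (hN : 3 ≤ N) (u : PressureList N) (l : List (Fin N × ℤˣ))
    (hl : l.length = 3 * N * N) (hv : run u l ∉ ladder N) :
    (N : ℤ) - peak (run u l) ≤ pathCost u l := by
  have h0 := pathCost_nonneg u l
  have hlen : ((N - 2) + 1) * (3 * N) + 3 * N ≤ l.length := by
    obtain ⟨m, rfl⟩ : ∃ m, N = m + 2 := ⟨N - 2, by omega⟩
    rw [hl]; simp only [Nat.add_sub_cancel]; apply le_of_eq; ring
  by_contra! hlt
  rcases Nat.eq_zero_or_pos (peak (run u l)) with hp | hp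
  · have hz := eq_zero_of_peak_eq_zero hp
    rw [hp] at hlt
    obtain ⟨l', i, rfl⟩ : ∃ l' i, l = l' ++ [i] := by
      refine ⟨l.dropLast, l.getLast ?_, (List.dropLast_append_getLast _).symm⟩
      rintro rfl
      simp at hlen; omega
    rw [run_append] at hz
    rw [pathCost_append] at hlt
    simp only [pathCost, run] at hz hlt
    obtain ⟨h1, h2⟩ := of_express_eq_zero hN hz
    -- without its last step the path costs less than `N - 1`, so it ends at a settled list
    refine h2 (settled_run_of_length (by omega) (N - 2) (by omega) u l' ?_ ?_)
    · simp only [List.length_append, List.length_singleton] at hlen; omega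
    · push_cast at hlt; omega
  · -- a cost less than `N - peak` is less than `N - 1` since the final list is not null
    have hs := settled_run_of_length (by omega) (N - 2) (by omega) u l (by omega) (by omega)
    exact hv (hs.mem_ladder (by omega))

/-! ### The embedded chain -/

/-- The rate at which the pair `i` is expressed when the list is `u`. -/
def rate (β : ℝ) (u : PressureList N) (i : Fin N × ℤˣ) : ℝ :=
  Real.exp (β * ((i.2 : ℤ) : ℝ) * (u.1 i.1 : ℝ))

/-- The rate at which the process leaves the list `u`. -/
def totalRate (β : ℝ) (u : PressureList N) : ℝ := ∑ i, rate β u i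

theorem rate_pos (β : ℝ) (u : PressureList N) (i : Fin N × ℤˣ) : 0 < rate β u i := Real.exp_pos _

theorem rate_eq (β : ℝ) (u : PressureList N) (i : Fin N × ℤˣ) :
    rate β u i = Real.exp (β * (peak u - stepCost u i)) := by
  simp only [rate, stepCost]; congr 1; push_cast; ring

theorem rate_le_exp_peak {β : ℝ} (hβ : 0 ≤ β) (u : PressureList N) (i : Fin N × ℤˣ) :
    rate β u i ≤ Real.exp (β * peak u) := by
  rw [rate_eq]
  have : (0 : ℝ) ≤ stepCost u i := by exact_mod_cast stepCost_nonneg u i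
  exact Real.exp_le_exp.2 (mul_le_mul_of_nonneg_left (by linarith) hβ)

theorem rate_le_totalRate (β : ℝ) (u : PressureList N) (i : Fin N × ℤˣ) :
    rate β u i ≤ totalRate β u :=
  Finset.single_le_sum (f := rate β u) (fun j _ => (rate_pos β u j).le) (Finset.mem_univ i)

theorem totalRate_pos (β : ℝ) (u : PressureList N) : 0 < totalRate β u :=
  (rate_pos β u (nonempty_pairs u).some).trans_le (rate_le_totalRate β u _)

theorem exp_peak_le_totalRate (β : ℝ) (u : PressureList N) :
    Real.exp (β * peak u) ≤ totalRate β u := by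
  obtain ⟨i, hi⟩ := exists_stepCost_eq_zero u
  have := rate_le_totalRate β u i
  rwa [rate_eq, hi, Int.cast_zero, sub_zero] at this

theorem card_pairs : Fintype.card (Fin N × ℤˣ) = 2 * N := by
  simp [Fintype.card_prod, mul_comm]

theorem totalRate_le {β c : ℝ} {u : PressureList N} (h : ∀ i, rate β u i ≤ c) :
    totalRate β u ≤ 2 * N * c := by
  have := Finset.sum_le_card_nsmul Finset.univ (rate β u) c fun i _ => h i
  rw [Finset.card_univ, card_pairs, nsmul_eq_mul] at this
  exact_mod_cast this

/-- The probability that the pair `i` is the first to be expressed when the list is `u`. -/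
def stepProb (β : ℝ) (u : PressureList N) (i : Fin N × ℤˣ) : ENNReal :=
  ENNReal.ofReal (rate β u i / totalRate β u)

theorem sum_stepProb (β : ℝ) (u : PressureList N) : ∑ i, stepProb β u i = 1 := by
  simp only [stepProb]
  rw [← ENNReal.ofReal_sum_of_nonneg fun i _ => div_nonneg (rate_pos β u i).le
    (totalRate_pos β u).le, ← Finset.sum_div, ← totalRate, div_self (totalRate_pos β u).ne',
    ENNReal.ofReal_one]

theorem stepProb_le (β : ℝ) (u : PressureList N) (i : Fin N × ℤˣ) :
    stepProb β u i ≤ ENNReal.ofReal (Real.exp (-β * stepCost u i)) := by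
  refine ENNReal.ofReal_le_ofReal ?_
  rw [div_le_iff₀ (totalRate_pos β u)]
  refine le_trans (le_of_eq ?_) (mul_le_mul_of_nonneg_left (exp_peak_le_totalRate β u)
    (Real.exp_pos _).le)
  rw [rate_eq, ← Real.exp_add]; congr 1; ring

/-- The transition operator of the embedded chain. -/
def stepAvg (β : ℝ) (F : PressureList N → ENNReal) (u : PressureList N) : ENNReal :=
  ∑ i, stepProb β u i * F (express i.1 i.2 u)

theorem stepAvg_iterate_one (β : ℝ) (n : ℕ) (u : PressureList N) :
    (stepAvg β)^[n] (fun _ => 1) u = 1 := by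
  have : stepAvg β (fun _ : PressureList N => (1 : ENNReal)) = fun _ => 1 := by
    ext u; simp [stepAvg, sum_stepProb]
  rw [Function.iterate_fixed this]

open Classical in
theorem stepAvg_iterate_eq_tsum (β : ℝ) (n : ℕ) (F : PressureList N → ENNReal)
    (u : PressureList N) :
    (stepAvg β)^[n] F u = ∑' v, (stepAvg β)^[n] (Pi.single v 1) u * F v := by
  induction n generalizing u with
  | zero =>
    rw [tsum_eq_single u fun v hv => by simp [hv.symm]]
    simp
  | succ n ih =>
    simp only [Function.iterate_succ_apply']
    simp only [stepAvg, Finset.sum_mul]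
    rw [Summable.tsum_finsetSum fun _ _ => ENNReal.summable]
    refine Finset.sum_congr rfl fun i _ => ?_
    rw [ih, ← ENNReal.tsum_mul_left]
    exact tsum_congr fun v => (mul_assoc _ _ _).symm

open Classical in
/-- The probability that the embedded chain is at `v` after `n` steps, if reaching `v` in `n` steps
costs at least `c`. -/
theorem stepAvg_iterate_le {β : ℝ} (hβ : 0 ≤ β) (n : ℕ) (u v : PressureList N) (c : ℤ)
    (h : ∀ l : List (Fin N × ℤˣ), l.length = n → run u l = v → c ≤ pathCost u l) :
    (stepAvg β)^[n] (Pi.single v 1) u ≤ (2 * N) ^ n * ENNReal.ofReal (Real.exp (-β * c)) := by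
  induction n generalizing u c with
  | zero =>
    rw [pow_zero, one_mul, Function.iterate_zero_apply, Pi.single_apply]
    split_ifs with huv
    · have : c ≤ 0 := h [] rfl huv
      rw [ENNReal.one_le_ofReal, Real.one_le_exp_iff]
      exact mul_nonneg_of_nonpos_of_nonpos (by linarith) (by exact_mod_cast this)
    · exact zero_le
  | succ n ih =>
    rw [Function.iterate_succ_apply', stepAvg]
    calc _ ≤ ∑ i : Fin N × ℤˣ, ENNReal.ofReal (Real.exp (-β * stepCost u i)) *
          ((2 * N) ^ n * ENNReal.ofReal (Real.exp (-β * (c - stepCost u i : ℤ)))) := by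
          refine Finset.sum_le_sum fun i _ => mul_le_mul' (stepProb_le β u i) (ih _ _ ?_)
          intro l hl hr
          have := h (i :: l) (by simp [hl]) hr
          simp only [pathCost] at this
          omega
      _ = ∑ i : Fin N × ℤˣ, (2 * N) ^ n * ENNReal.ofReal (Real.exp (-β * c)) := by
          refine Finset.sum_congr rfl fun i _ => ?_
          rw [mul_left_comm, ← ENNReal.ofReal_mul (Real.exp_pos _).le, ← Real.exp_add]
          congr 4; push_cast; ring
      _ = _ := by
          rw [Finset.sum_const, Finset.card_univ, card_pairs, nsmul_eq_mul]; push_cast; ring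

/-! ### Easy paths -/

/-- Each pair of the path has a rate at least `κ` times the rate of any other pair. -/
def EasyPath (β κ : ℝ) : PressureList N → List (Fin N × ℤˣ) → Prop
  | _, [] => True
  | u, i :: l => (∀ j, κ * rate β u j ≤ rate β u i) ∧ EasyPath β κ (express i.1 i.2 u) l

theorem EasyPath.append {β κ : ℝ} {u : PressureList N} {l l' : List (Fin N × ℤˣ)}
    (h : EasyPath β κ u l) (h' : EasyPath β κ (run u l) l') : EasyPath β κ u (l ++ l') := by
  induction l generalizing u with
  | nil => exact h'
  | cons i l ih => exact ⟨h.1, ih h.2 h'⟩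

theorem easyPath_of_pathCost_eq_zero {β κ : ℝ} (hβ : 0 ≤ β) (hκ : κ ≤ 1) {u : PressureList N}
    {l : List (Fin N × ℤˣ)} (h : pathCost u l = 0) : EasyPath β κ u l := by
  induction l generalizing u with
  | nil => trivial
  | cons i l ih =>
    have h1 := stepCost_nonneg u i
    have h2 := pathCost_nonneg (express i.1 i.2 u) l
    simp only [pathCost] at h
    refine ⟨fun j => ?_, ih (by omega)⟩
    calc κ * rate β u j ≤ 1 * rate β u j := mul_le_mul_of_nonneg_right hκ (rate_pos β u j).le
      _ ≤ Real.exp (β * peak u) := by rw [one_mul]; exact rate_le_exp_peak hβ u j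
      _ = rate β u i := by
        rw [rate_eq, show stepCost u i = 0 by omega, Int.cast_zero, sub_zero]

theorem peak_express_le (u : PressureList N) (i : Fin N × ℤˣ) :
    peak (express i.1 i.2 u) ≤ peak u + 1 := by
  obtain ⟨a, ha⟩ := exists_abs_eq_peak (express i.1 i.2 u)
  by_cases h : a = i.1
  · rw [h, express_self, abs_zero] at ha; omega
  · rw [express_ne h] at ha
    have := abs_add_le (u.1 a) (i.2 : ℤ)
    have h1 : |(i.2 : ℤ)| = 1 := by rcases units_cases i.2 with h | h <;> rw [h] <;> rfl
    have := abs_le_peak u a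
    omega

theorem easyPath_of_peak_le {β : ℝ} (hβ : 0 ≤ β) {m : ℕ} {u : PressureList N}
    {l : List (Fin N × ℤˣ)} (h : peak u + l.length ≤ m) :
    EasyPath β (Real.exp (-(2 * m * β))) u l := by
  induction l generalizing u with
  | nil => trivial
  | cons i l ih =>
    rw [List.length_cons] at h
    refine ⟨fun j => ?_, ih (by have := peak_express_le u i; omega)⟩
    rw [rate, rate, ← Real.exp_add]
    refine Real.exp_le_exp.2 ?_
    have hm : (peak u : ℤ) ≤ m := by exact_mod_cast (by omega : peak u ≤ m)
    have h1 : (j.2 : ℤ) * u.1 j.1 ≤ m := (units_mul_le_peak u j.2 j.1).trans hm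
    have h2 : -((i.2 : ℤ) * u.1 i.1) ≤ m := by
      have := units_mul_le_peak u (-i.2) i.1
      rw [Units.val_neg, neg_mul] at this
      exact this.trans hm
    have h1' : ((j.2 : ℤ) : ℝ) * u.1 j.1 ≤ m := by exact_mod_cast h1
    have h2' : -(((i.2 : ℤ) : ℝ) * u.1 i.1) ≤ m := by exact_mod_cast h2
    have h3 := mul_le_mul_of_nonneg_left h1' hβ
    have h4 := mul_le_mul_of_nonneg_left h2' hβ
    linarith

theorem run_map_of_notMem (l : List (Fin N)) (u : PressureList N) {b : Fin N} (hb : b ∉ l) :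
    (run u (l.map fun a => (a, 1))).1 b = u.1 b + l.length := by
  induction l generalizing u with
  | nil => simp [run]
  | cons a l ih =>
    rw [List.mem_cons, not_or] at hb
    simp only [List.map_cons, run, List.length_cons]
    rw [ih _ hb.2, express_ne hb.1]
    push_cast; ring

theorem run_map_of_mem (l : List (Fin N)) (u u' : PressureList N) {b : Fin N} (hb : b ∈ l) :
    (run u (l.map fun a => (a, 1))).1 b = (run u' (l.map fun a => (a, 1))).1 b := by
  induction l generalizing u u' with
  | nil => simp at hb
  | cons a l ih =>
    simp only [List.map_cons, run]
    by_cases hl : b ∈ l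
    · exact ih _ _ hl
    · obtain rfl : b = a := by simpa [hl] using hb
      rw [run_map_of_notMem _ _ hl, run_map_of_notMem _ _ hl, express_self, express_self]

/-- Some list can be reached from any list by an easy path of a fixed length: once the pressures are
bounded, the actors express the opinion `1` one after the other. -/
theorem exists_easyPath (hN : 1 ≤ N) : ∃ v₀ : PressureList N, ∀ β : ℝ, 0 ≤ β → ∃ κ : ℝ, 0 < κ ∧
    κ ≤ 1 ∧ ∀ u : PressureList N, ∃ l : List (Fin N × ℤˣ), l.length = 2 * N ∧ run u l = v₀ ∧
      EasyPath β κ u l := by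
  refine ⟨run ⟨0, ⟨⟨0, hN⟩, rfl⟩⟩ ((List.finRange N).map fun a => (a, 1)), fun β hβ =>
    ⟨Real.exp (-(2 * (2 * N : ℕ) * β)), Real.exp_pos _, ?_, fun u => ?_⟩⟩
  · rw [Real.exp_le_one_iff]
    have : (0 : ℝ) ≤ 2 * (2 * N : ℕ) * β := by positivity
    linarith
  · obtain ⟨l, hl, hc⟩ := exists_run_pathCost_eq_zero N u
    refine ⟨l ++ (List.finRange N).map fun a => (a, 1), by simp [hl]; ring, ?_, ?_⟩
    · rw [run_append]
      exact Subtype.ext (funext fun b => run_map_of_mem _ _ _ (List.mem_finRange b))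
    · refine (easyPath_of_pathCost_eq_zero hβ ?_ hc).append (easyPath_of_peak_le hβ ?_)
      · rw [Real.exp_le_one_iff]
        have : (0 : ℝ) ≤ 2 * (2 * N : ℕ) * β := by positivity
        linarith
      · have hp : peak (run u l) ≤ N := by
          obtain ⟨a, ha⟩ := exists_abs_eq_peak (run u l)
          have := abs_le_of_pathCost_eq_zero u l hl hc a
          omega
        simp; omega

theorem le_stepProb {β κ : ℝ} {u : PressureList N} {i : Fin N × ℤˣ} (hκ : 0 < κ)
    (h : ∀ j, κ * rate β u j ≤ rate β u i) : ENNReal.ofReal (κ / (2 * N)) ≤ stepProb β u i := by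
  refine ENNReal.ofReal_le_ofReal ?_
  have hN : 0 < N := i.1.pos
  have h1 : totalRate β u ≤ 2 * N * (rate β u i / κ) :=
    totalRate_le fun j => by rw [le_div_iff₀ hκ, mul_comm]; exact h j
  rw [div_le_div_iff₀ (by positivity) (totalRate_pos β u)]
  calc κ * totalRate β u ≤ κ * (2 * N * (rate β u i / κ)) := mul_le_mul_of_nonneg_left h1 hκ.le
    _ = rate β u i * (2 * N) := by field_simp

theorem EasyPath.le_stepAvg_iterate {β κ : ℝ} (hκ : 0 < κ) {u : PressureList N}
    {l : List (Fin N × ℤˣ)} (h : EasyPath β κ u l) {F : PressureList N → ENNReal}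
    (hF : 1 ≤ F (run u l)) :
    ENNReal.ofReal (κ / (2 * N)) ^ l.length ≤ (stepAvg β)^[l.length] F u := by
  induction l generalizing u with
  | nil => simpa [run] using hF
  | cons i l ih =>
    rw [List.length_cons, Function.iterate_succ_apply', pow_succ']
    exact (mul_le_mul' (le_stepProb hκ h.1) (ih h.2 hF)).trans
      (Finset.single_le_sum (f := fun i => stepProb β u i * (stepAvg β)^[l.length] F
        (express i.1 i.2 u)) (fun _ _ => zero_le) (Finset.mem_univ i))

/-! ### The stationary law of the embedded chain -/

open Classical in
/-- A stochastic matrix with a column bounded below has an invariant law: with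
`R u v = K u v - ε * 1_{v = v₀}`, it is `ε * ∑ k, δ_{v₀} R ^ k`. -/
theorem exists_invariant_of_le {S : Type*} (K : S → S → ENNReal) (hK : ∀ u, ∑' v, K u v = 1)
    (v₀ : S) {ε : ENNReal} (hε : ε ≠ 0) (h : ∀ u, ε ≤ K u v₀) :
    ∃ ν : S → ENNReal, ∑' u, ν u = 1 ∧ ∀ v, ∑' u, ν u * K u v = ν v := by
  have hε1 : ε ≤ 1 := (h v₀).trans ((ENNReal.le_tsum v₀).trans_eq (hK v₀))
  have hεt : ε ≠ ⊤ := (hε1.trans_lt ENNReal.one_lt_top).ne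
  set D : S → ENNReal := Pi.single v₀ ε with hD
  have hDs : ∑' v, D v = ε := by
    rw [tsum_eq_single v₀ fun v hv => by simp [hD, hv]]; simp [hD]
  have hDK : ∀ u v, D v ≤ K u v := by
    intro u v
    by_cases hv : v = v₀
    · subst hv; simpa [hD] using h u
    · simp [hD, hv]
  set R : S → S → ENNReal := fun u v => K u v - D v with hR
  have hRK : ∀ u v, R u v + D v = K u v := fun u v => tsub_add_cancel_of_le (hDK u v)
  have hRs : ∀ u, ∑' v, R u v = 1 - ε := by
    intro u
    have : ∑' v, R u v + ε = 1 := by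
      rw [← hDs, ← ENNReal.tsum_add, ← hK u]; exact tsum_congr (hRK u)
    exact ENNReal.eq_sub_of_add_eq hεt this
  let x : ℕ → S → ENNReal := fun k => k.rec D fun _ y v => ∑' u, y u * R u v
  have hx : ∀ k v, x (k + 1) v = ∑' u, x k u * R u v := fun k v => rfl
  have hxs : ∀ k, ∑' v, x k v = ε * (1 - ε) ^ k := by
    intro k
    induction k with
    | zero => rw [pow_zero, mul_one]; exact hDs
    | succ k ih =>
      simp only [hx]
      rw [ENNReal.tsum_comm]
      simp only [ENNReal.tsum_mul_left, hRs, ENNReal.tsum_mul_right, ih, pow_succ, mul_assoc]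
  have hνs : ∑' u, ∑' k, x k u = 1 := by
    rw [ENNReal.tsum_comm]
    simp only [hxs]
    rw [ENNReal.tsum_mul_left, ENNReal.tsum_geometric, ENNReal.sub_sub_cancel ENNReal.one_ne_top
      hε1, ENNReal.mul_inv_cancel hε hεt]
  refine ⟨fun v => ∑' k, x k v, hνs, fun v => ?_⟩
  simp only [← hRK, mul_add]
  rw [ENNReal.tsum_add, ENNReal.tsum_mul_right, hνs, one_mul]
  simp only [← ENNReal.tsum_mul_right]
  rw [ENNReal.tsum_comm]
  simp only [← hx]
  rw [tsum_eq_zero_add' (f := fun k => x k v) ENNReal.summable, add_comm]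
  rfl

/-- The invariance of a law under the embedded chain, in terms of test functions. -/
def IsStationary (β : ℝ) (ν : PressureList N → ENNReal) : Prop :=
  ∀ F : PressureList N → ENNReal, ∑' u, ν u * stepAvg β F u = ∑' u, ν u * F u

theorem IsStationary.iterate {β : ℝ} {ν : PressureList N → ENNReal} (h : IsStationary β ν) (n : ℕ)
    (F : PressureList N → ENNReal) :
    ∑' u, ν u * (stepAvg β)^[n] F u = ∑' u, ν u * F u := by
  induction n with
  | zero => rfl
  | succ n ih => simp only [Function.iterate_succ_apply']; rw [h, ih]

open Classical in
theorem exists_isStationary (hN : 1 ≤ N) {β : ℝ} (hβ : 0 ≤ β) :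
    ∃ ν : PressureList N → ENNReal, ∑' u, ν u = 1 ∧ IsStationary β ν := by
  obtain ⟨v₀, hv₀⟩ := exists_easyPath hN
  obtain ⟨κ, hκ, -, hpath⟩ := hv₀ β hβ
  set m := 2 * N with hm
  have hm0 : (m : ENNReal) ≠ 0 := by simp [hm]; omega
  have hsum : ∀ n (u : PressureList N), ∑' v, (stepAvg β)^[n] (Pi.single v 1) u = 1 := by
    intro n u
    simpa [stepAvg_iterate_one] using (stepAvg_iterate_eq_tsum β n (fun _ => 1) u).symm
  obtain ⟨ν, hν1, hν⟩ := exists_invariant_of_le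
    (fun u v : PressureList N => (stepAvg β)^[m] (Pi.single v 1) u) (hsum m) v₀
    (ε := ENNReal.ofReal (κ / (2 * N)) ^ m) (pow_ne_zero _ (by simp; positivity)) (by
      intro u
      obtain ⟨l, hl, hr, he⟩ := hpath u
      have := he.le_stepAvg_iterate hκ (F := Pi.single v₀ 1) (by simp [hr])
      rwa [hl] at this)
  -- a law invariant under `m` steps is averaged over `m` successive steps
  have hνm : ∀ F : PressureList N → ENNReal,
      ∑' u, ν u * (stepAvg β)^[m] F u = ∑' u, ν u * F u := by
    intro F
    simp only [stepAvg_iterate_eq_tsum β m F, ← ENNReal.tsum_mul_left]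
    rw [ENNReal.tsum_comm]
    refine tsum_congr fun v => ?_
    rw [← hν v, ← ENNReal.tsum_mul_right]
    exact tsum_congr fun u => (mul_assoc _ _ _).symm
  set ν' : PressureList N → ENNReal := fun v =>
    (m : ENNReal)⁻¹ * ∑ j ∈ Finset.range m, ∑' u, ν u * (stepAvg β)^[j] (Pi.single v 1) u with hν'
  have key : ∀ F, ∑' v, ν' v * F v =
      (m : ENNReal)⁻¹ * ∑ j ∈ Finset.range m, ∑' u, ν u * (stepAvg β)^[j] F u := by
    intro F
    simp only [hν', mul_assoc]
    rw [ENNReal.tsum_mul_left]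
    congr 1
    simp only [Finset.sum_mul]
    rw [Summable.tsum_finsetSum fun _ _ => ENNReal.summable]
    refine Finset.sum_congr rfl fun j _ => ?_
    simp only [stepAvg_iterate_eq_tsum β j F, ← ENNReal.tsum_mul_left, ← ENNReal.tsum_mul_right]
    rw [ENNReal.tsum_comm]
    exact tsum_congr fun u => tsum_congr fun v => mul_assoc _ _ _
  refine ⟨ν', ?_, fun F => ?_⟩
  · have := key fun _ => 1
    simp only [mul_one, stepAvg_iterate_one, hν1] at this
    rw [this]
    simp [ENNReal.inv_mul_cancel hm0]
  · rw [key, key]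
    congr 1
    obtain ⟨k, hk⟩ : ∃ k, m = k + 1 := ⟨m - 1, by omega⟩
    have h1 := hνm F
    rw [hk] at h1 ⊢
    rw [Finset.sum_range_succ, Finset.sum_range_succ' (n := k)]
    simp only [← Function.iterate_succ_apply]
    rw [h1]
    rfl

/-! ### Concentration on the ladder lists -/

theorem finite_peak_lt (n : ℕ) : {u : PressureList N | peak u < n}.Finite := by
  have : (Set.univ.pi fun _ : Fin N => Set.Icc (-(n : ℤ)) n).Finite :=
    Set.Finite.pi fun _ => Set.finite_Icc _ _
  refine (this.preimage Subtype.val_injective.injOn).subset fun u hu a _ => ?_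
  have h1 := abs_le.1 (abs_le_peak u a)
  simp only [Set.mem_ofPred_eq] at hu
  exact ⟨by omega, by omega⟩

theorem peak_of_mem_ladder {u : PressureList N} (h : u ∈ ladder N) : peak u + 1 ≤ N := by
  obtain ⟨a, ha⟩ := exists_abs_eq_peak u
  have : |u.1 a| + 1 ≤ N := by
    rcases h with h | h
    · have : u.1 a ∈ Set.Ico 0 (N : ℤ) := h ▸ Set.mem_range_self a
      rw [abs_of_nonneg this.1]; have := this.2; omega
    · have : u.1 a ∈ Set.Ioc (-(N : ℤ)) 0 := h ▸ Set.mem_range_self a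
      rw [abs_of_nonpos this.2]; have := this.1; omega
  omega

/-- The density, with respect to the counting measure, of the invariant measure of the process
associated to the law `ν` of the embedded chain. -/
def timeDensity (β : ℝ) (ν : PressureList N → ENNReal) (u : PressureList N) : ENNReal :=
  ν u / ENNReal.ofReal (totalRate β u)

open Classical in
theorem le_of_notMem_ladder (hN : 3 ≤ N) {β : ℝ} (hβ : 0 ≤ β) {ν : PressureList N → ENNReal}
    (h1 : ∑' u, ν u = 1) (hν : IsStationary β ν) {v : PressureList N} (hv : v ∉ ladder N) :
    ν v ≤ (2 * N) ^ (3 * N * N) * ENNReal.ofReal (Real.exp (-β * (N - peak v))) := by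
  have := hν.iterate (3 * N * N) (Pi.single v 1)
  rw [tsum_eq_single (f := fun u => ν u * (Pi.single v 1 : PressureList N → ENNReal) u) v
    fun u hu => by simp [hu], Pi.single_eq_same, mul_one] at this
  rw [← this]
  calc _ ≤ ∑' u, ν u * ((2 * N) ^ (3 * N * N) *
        ENNReal.ofReal (Real.exp (-β * (N - peak v : ℤ)))) := by
        refine ENNReal.tsum_le_tsum fun u => mul_le_mul_right (stepAvg_iterate_le hβ _ u v _ ?_) _
        rintro l hl rfl
        exact sub_peak_le_pathCost hN u l hl hv
    _ = _ := by rw [ENNReal.tsum_mul_right, h1, one_mul]; push_cast; rfl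

theorem le_tsum_indicator_ladder (hN : 3 ≤ N) {β : ℝ} (hβ : 0 ≤ β) {ν : PressureList N → ENNReal}
    (h1 : ∑' u, ν u = 1) (hν : IsStationary β ν) :
    ENNReal.ofReal (1 / (2 * N)) ^ (3 * N) ≤ ∑' u, (ladder N).indicator ν u := by
  have h2 : ∀ u, (ladder N).indicator ν u = ν u * (ladder N).indicator 1 u := by
    intro u; by_cases hu : u ∈ ladder N <;> simp [hu]
  rw [tsum_congr h2, ← hν.iterate (3 * N), ← one_mul (_ ^ _), ← h1, ← ENNReal.tsum_mul_right]
  refine ENNReal.tsum_le_tsum fun u => mul_le_mul_right ?_ _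
  obtain ⟨l, hl, hc⟩ := exists_run_pathCost_eq_zero (3 * N) u
  have := (easyPath_of_pathCost_eq_zero hβ le_rfl hc).le_stepAvg_iterate one_pos
    (F := (ladder N).indicator 1) (by simp [run_mem_ladder (by omega) u l hl hc])
  rwa [hl] at this

theorem tsum_indicator_compl_le (hN : 3 ≤ N) {β : ℝ} (hβ : 0 ≤ β) {ν : PressureList N → ENNReal}
    (h1 : ∑' u, ν u = 1) (hν : IsStationary β ν) :
    ∑' u, (ladder N)ᶜ.indicator (timeDensity β ν) u ≤ ENNReal.ofReal (Real.exp (-β * N)) *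
      ((2 * N) ^ (3 * N * N) * (finite_peak_lt (N := N) N).toFinset.card + 1) := by
  set s := (finite_peak_lt (N := N) N).toFinset with hs
  have hle : ∀ u, (ladder N)ᶜ.indicator (timeDensity β ν) u ≤ ENNReal.ofReal (Real.exp (-β * N)) *
      ((2 * N) ^ (3 * N * N) * (s : Set (PressureList N)).indicator 1 u + ν u) := by
    intro u
    by_cases hu : u ∈ ladder N
    · simp [hu]
    rw [Set.indicator_of_mem (by exact hu), timeDensity]
    refine ENNReal.div_le_of_le_mul ?_
    by_cases hp : peak u < N
    · have hus : u ∈ (s : Set (PressureList N)) := by simpa [hs] using hp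
      rw [Set.indicator_of_mem hus, Pi.one_apply, mul_one]
      calc ν u ≤ _ := le_of_notMem_ladder hN hβ h1 hν hu
        _ = ENNReal.ofReal (Real.exp (-β * N)) * (2 * N) ^ (3 * N * N) *
            ENNReal.ofReal (Real.exp (β * peak u)) := by
          rw [mul_right_comm (ENNReal.ofReal _), ← ENNReal.ofReal_mul (Real.exp_pos _).le,
            ← Real.exp_add, mul_comm]
          congr 3; ring
        _ ≤ _ := by
          refine mul_le_mul' (mul_le_mul_right le_self_add _) ?_
          exact ENNReal.ofReal_le_ofReal (exp_peak_le_totalRate β u)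
    · calc
        ν u = ENNReal.ofReal (Real.exp (-β * N)) * ν u * ENNReal.ofReal (Real.exp (β * N)) := by
          rw [mul_right_comm, ← ENNReal.ofReal_mul (Real.exp_pos _).le, ← Real.exp_add]
          simp
        _ ≤ _ := by
          refine mul_le_mul' (mul_le_mul_right le_add_self _) (ENNReal.ofReal_le_ofReal ?_)
          refine le_trans (Real.exp_le_exp.2 ?_) (exp_peak_le_totalRate β u)
          exact mul_le_mul_of_nonneg_left (by exact_mod_cast not_lt.1 hp) hβ
  refine (ENNReal.tsum_le_tsum hle).trans_eq ?_
  rw [ENNReal.tsum_mul_left, ENNReal.tsum_add, ENNReal.tsum_mul_left, h1, ← tsum_subtype]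
  simp

theorem le_tsum_indicator_timeDensity (hN : 3 ≤ N) {β : ℝ} (hβ : 0 ≤ β)
    {ν : PressureList N → ENNReal} (h1 : ∑' u, ν u = 1) (hν : IsStationary β ν) :
    ENNReal.ofReal (1 / (2 * N)) ^ (3 * N) / ENNReal.ofReal (2 * N * Real.exp (β * (N - 1))) ≤
      ∑' u, (ladder N).indicator (timeDensity β ν) u := by
  calc _ ≤ (∑' u, (ladder N).indicator ν u) /
        ENNReal.ofReal (2 * N * Real.exp (β * (N - 1))) :=
        ENNReal.div_le_div_right (le_tsum_indicator_ladder hN hβ h1 hν) _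
    _ = ∑' u, (ladder N).indicator ν u / ENNReal.ofReal (2 * N * Real.exp (β * (N - 1))) := by
        simp only [div_eq_mul_inv, ENNReal.tsum_mul_right]
    _ ≤ _ := by
        refine ENNReal.tsum_le_tsum fun u => ?_
        by_cases hu : u ∈ ladder N
        · rw [Set.indicator_of_mem hu, Set.indicator_of_mem hu, timeDensity]
          refine ENNReal.div_le_div_left (ENNReal.ofReal_le_ofReal (totalRate_le fun i => ?_)) _
          refine (rate_le_exp_peak hβ u i).trans (Real.exp_le_exp.2
            (mul_le_mul_of_nonneg_left ?_ hβ))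
          have : (peak u : ℝ) + 1 ≤ N := by exact_mod_cast peak_of_mem_ladder hu
          linarith
        · simp [hu]

/-- The invariant density is concentrated on the ladder lists up to a factor `exp (-β)`. -/
theorem exists_compl_le_mul_ladder (hN : 3 ≤ N) : ∃ C : ℝ, 0 < C ∧ ∀ β : ℝ, 0 ≤ β →
    ∀ ν : PressureList N → ENNReal, ∑' u, ν u = 1 → IsStationary β ν →
      ∑' u, (ladder N)ᶜ.indicator (timeDensity β ν) u ≤
        ENNReal.ofReal (C * Real.exp (-β)) * ∑' u, (ladder N).indicator (timeDensity β ν) u := by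
  have hN0 : (0 : ℝ) < N := by exact_mod_cast (by omega : 0 < N)
  set A : ℝ := (2 * N) ^ (3 * N * N) * (finite_peak_lt (N := N) N).toFinset.card + 1 with hA
  have hA0 : 0 < A := by positivity
  refine ⟨A * (2 * N) ^ (3 * N + 1), by positivity, fun β hβ ν h1 hν => ?_⟩
  refine (tsum_indicator_compl_le hN hβ h1 hν).trans ?_
  refine le_trans (le_of_eq ?_) (mul_le_mul_right (le_tsum_indicator_timeDensity hN hβ h1 hν) _)
  rw [← ENNReal.ofReal_pow (by positivity), ← ENNReal.ofReal_div_of_pos (by positivity),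
    ← ENNReal.ofReal_mul (by positivity)]
  have : ((2 * N : ENNReal) ^ (3 * N * N) * (finite_peak_lt (N := N) N).toFinset.card + 1) =
      ENNReal.ofReal A := by
    rw [hA, ENNReal.ofReal_add (by positivity) (by positivity),
      ENNReal.ofReal_mul (by positivity), ENNReal.ofReal_pow (by positivity),
      ENNReal.ofReal_mul (by positivity)]
    simp
  rw [this, ← ENNReal.ofReal_mul (Real.exp_pos _).le]
  congr 1
  have : Real.exp (-β * N) * Real.exp (β * (N - 1)) = Real.exp (-β) := by
    rw [← Real.exp_add]; congr 1; ring
  rw [← this, one_div, inv_pow]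
  field_simp
  ring

/-! ### Independent exponential clocks -/

theorem lintegral_expMeasure (r : ℝ) {f : ℝ → ENNReal} (hf : Measurable f) :
    ∫⁻ x, f x ∂expMeasure r = ∫⁻ x, exponentialPDF r x * f x :=
  lintegral_withDensity_eq_lintegral_mul _
    (measurable_exponentialPDFReal r).ennreal_ofReal hf

theorem expMeasure_Iic {r : ℝ} (hr : 0 < r) (x : ℝ) :
    expMeasure r (Set.Iic x) = ENNReal.ofReal (if 0 ≤ x then 1 - Real.exp (-(r * x)) else 0) := by
  rw [← lintegral_exponentialPDF_eq_antiDeriv hr x]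
  exact withDensity_apply _ measurableSet_Iic

instance : NullSingletonClass (expMeasure 1) :=
  inferInstanceAs (NullSingletonClass (volume.withDensity _))

theorem expMeasure_Ioi {r : ℝ} (hr : 0 < r) {x : ℝ} (hx : 0 ≤ x) :
    expMeasure r (Set.Ioi x) = ENNReal.ofReal (Real.exp (-(r * x))) := by
  have := isProbabilityMeasure_expMeasure hr
  rw [← Set.compl_Iic, prob_compl_eq_one_sub measurableSet_Iic, expMeasure_Iic hr, if_pos hx,
    ← ENNReal.ofReal_one, ← ENNReal.ofReal_sub _ (by
      rw [sub_nonneg, Real.exp_le_one_iff]; have := mul_nonneg hr.le hx; linarith)]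
  congr 1; ring

theorem expMeasure_Ici {x : ℝ} (hx : 0 ≤ x) :
    expMeasure 1 (Set.Ici x) = ENNReal.ofReal (Real.exp (-x)) := by
  rw [← measure_congr Ioi_ae_eq_Ici, expMeasure_Ioi one_pos hx, one_mul]

/-- The law of the exponential variables used at each step. -/
def clockLaw (N : ℕ) : Measure (Fin N × ℤˣ → ℝ) := Measure.pi fun _ => expMeasure 1

instance : IsProbabilityMeasure (clockLaw N) := by unfold clockLaw; infer_instance

instance : IsProbabilityMeasure (prob N) := by unfold prob; infer_instance

theorem prob_eq_infinitePi : prob N = Measure.infinitePi fun _ : ℕ => clockLaw N := rfl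

theorem measurePreserving_eval_prob (n : ℕ) :
    MeasurePreserving (fun ω : Sample N => ω n) (prob N) (clockLaw N) :=
  measurePreserving_eval_infinitePi (fun _ : ℕ => clockLaw N) n

theorem measurePreserving_eval_clockLaw (i : Fin N × ℤˣ) :
    MeasurePreserving (fun e : Fin N × ℤˣ → ℝ => e i) (clockLaw N) (expMeasure 1) :=
  measurePreserving_eval (fun _ => expMeasure 1) i

/-- The sample with first term `p.1`, followed by the terms of `p.2`. -/
def consSample (p : (Fin N × ℤˣ → ℝ) × Sample N) : Sample N
  | 0 => p.1
  | n + 1 => p.2 n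

theorem measurable_consSample : Measurable (consSample (N := N)) := by
  refine measurable_pi_iff.2 fun n => ?_
  cases n with
  | zero => exact measurable_fst
  | succ n => exact (measurable_pi_apply n).comp measurable_snd

/-- The first term of a sample and the sequence of the following ones are independent, and the
latter has the law of a sample. -/
theorem map_consSample : ((clockLaw N).prod (prob N)).map consSample = prob N := by
  classical
  refine Measure.eq_infinitePi _ fun s t ht => ?_
  -- the box is written as a box over an initial segment of `ℕ`
  obtain ⟨n, hn⟩ : ∃ n, s ⊆ Finset.range (n + 1) :=
    ⟨s.sup id, fun i hi => Finset.mem_range.2 (Nat.lt_succ_of_le (Finset.le_sup (f := id) hi))⟩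
  set t' : ℕ → Set (Fin N × ℤˣ → ℝ) := fun i => if i ∈ s then t i else Set.univ with ht'
  have ht'm : ∀ i, MeasurableSet (t' i) := by
    intro i; simp only [ht']; split_ifs
    · exact ht i
    · exact .univ
  have h1 : Set.pi (s : Set ℕ) t = {ω | ∀ i ∈ Finset.range (n + 1), ω i ∈ t' i} := by
    ext ω
    simp only [Set.mem_pi, Finset.mem_coe, Set.mem_ofPred_eq, ht']
    refine ⟨fun h i _ => ?_, fun h i hi => by simpa [hi] using h i (hn hi)⟩
    split_ifs with hi
    · exact h i hi
    · trivial
  have h2 : ∏ i ∈ s, clockLaw N (t i) = ∏ i ∈ Finset.range (n + 1), clockLaw N (t' i) := by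
    rw [← Finset.prod_subset hn (f := fun i => clockLaw N (t' i)) fun i _ hi => by simp [ht', hi]]
    exact Finset.prod_congr rfl fun i hi => by simp [ht', hi]
  have h3 : consSample ⁻¹' (Set.pi (s : Set ℕ) t) =
      t' 0 ×ˢ Set.pi (Finset.range n : Set ℕ) fun i => t' (i + 1) := by
    rw [h1]
    ext p
    simp only [Set.mem_preimage, Set.mem_ofPred_eq, Finset.mem_range, Set.mem_prod, Set.mem_pi,
      Finset.coe_range, Set.mem_Iio]
    refine ⟨fun h => ⟨h 0 (by omega), fun i hi => h (i + 1) (by omega)⟩, fun h i hi => ?_⟩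
    cases i with
    | zero => exact h.1
    | succ i => exact h.2 i (by omega)
  change _ = ∏ i ∈ s, clockLaw N (t i)
  rw [Measure.map_apply measurable_consSample (.pi s.countable_toSet fun i _ => ht i), h3, h2,
    Measure.prod_prod, prob_eq_infinitePi, Measure.infinitePi_pi _ fun i _ => ht'm _,
    Finset.prod_range_succ', mul_comm]

theorem measurable_update_pair (i : Fin N × ℤˣ) :
    Measurable fun p : ℝ × (Fin N × ℤˣ → ℝ) => Function.update p.2 i p.1 := by
  refine measurable_pi_iff.2 fun j => ?_
  by_cases h : j = i
  · subst h; simpa using measurable_fst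
  · simp only [Function.update_of_ne h]; fun_prop

/-- Resampling the coordinate `i` does not change the law of the clocks. -/
theorem map_update_clockLaw (i : Fin N × ℤˣ) :
    ((expMeasure 1).prod (clockLaw N)).map (fun p => Function.update p.2 i p.1) = clockLaw N := by
  classical
  refine (Measure.pi_eq fun s hs => ?_).symm
  have h : (fun p : ℝ × (Fin N × ℤˣ → ℝ) => Function.update p.2 i p.1) ⁻¹' Set.univ.pi s =
      s i ×ˢ Set.univ.pi (Function.update s i Set.univ) := by
    ext p
    simp only [Set.mem_preimage, Set.mem_pi, Set.mem_univ, true_imp_iff, Set.mem_prod]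
    refine ⟨fun h => ⟨by simpa using h i, fun j => ?_⟩, fun h j => ?_⟩
    · by_cases hj : j = i
      · subst hj; simp
      · simpa [hj] using h j
    · by_cases hj : j = i
      · subst hj; simpa using h.1
      · simpa [hj] using h.2 j
  rw [Measure.map_apply (measurable_update_pair i) (.univ_pi hs), h, Measure.prod_prod,
    clockLaw, Measure.pi_pi,
    ← Finset.mul_prod_erase _ _ (Finset.mem_univ i),
    ← Finset.mul_prod_erase _ _ (Finset.mem_univ i)]
  simp only [Function.update_self, measure_univ, one_mul]
  congr 1
  exact Finset.prod_congr rfl fun j hj => by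
    rw [Function.update_of_ne (Finset.ne_of_mem_erase hj)]

/-- Integration with respect to the coordinate `i` first. -/
theorem lintegral_clockLaw_eq_update (i : Fin N × ℤˣ) {F : (Fin N × ℤˣ → ℝ) → ENNReal}
    (hF : Measurable F) : ∫⁻ e, F e ∂clockLaw N =
      ∫⁻ x, ∫⁻ e, F (Function.update e i x) ∂clockLaw N ∂expMeasure 1 := by
  conv_lhs => rw [← map_update_clockLaw i]
  rw [lintegral_map hF (measurable_update_pair i)]
  exact lintegral_prod _ (hF.comp (measurable_update_pair i)).aemeasurable

theorem clock_eq (β : ℝ) (u : PressureList N) (e : Fin N × ℤˣ → ℝ) (i : Fin N × ℤˣ) :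
    clock β u e i = e i / rate β u i := rfl

theorem measurable_clock (β : ℝ) (u : PressureList N) (i : Fin N × ℤˣ) :
    Measurable fun e => clock β u e i := (measurable_pi_apply i).div_const _

theorem firstRing_le (β : ℝ) (u : PressureList N) (e : Fin N × ℤˣ → ℝ) (j : Fin N × ℤˣ) :
    clock β u e (firstRing β u e) ≤ clock β u e j :=
  haveI := nonempty_pairs u
  argMin_le (clock β u e) j

/-- The values of the exponential variables that are positive and never lead to a tie. -/
def goodClocks (N : ℕ) (β : ℝ) : Set (Fin N × ℤˣ → ℝ) :=
  {e | (∀ i, 0 < e i) ∧ ∀ (u : PressureList N) (i j), i ≠ j → clock β u e i ≠ clock β u e j}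

theorem measurableSet_goodClocks (β : ℝ) : MeasurableSet (goodClocks N β) := by
  simp only [goodClocks, Set.ofPred_and, Set.ofPred_forall]
  refine MeasurableSet.inter (MeasurableSet.iInter fun i => ?_) (MeasurableSet.iInter fun u =>
    MeasurableSet.iInter fun i => MeasurableSet.iInter fun j => MeasurableSet.iInter fun _ => ?_)
  · exact measurableSet_lt measurable_const (measurable_pi_apply i)
  · exact (measurableSet_eq_fun (measurable_clock β u i) (measurable_clock β u j)).compl

theorem ae_mem_goodClocks (β : ℝ) : ∀ᵐ e ∂clockLaw N, e ∈ goodClocks N β := by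
  refine Filter.Eventually.and (eventually_all.2 fun i => ?_) (ae_all_iff.2 fun u =>
    eventually_all.2 fun i => eventually_all.2 fun j => ?_)
  · refine (measurePreserving_eval_clockLaw i).quasiMeasurePreserving.ae
      (p := fun x => 0 < x) ?_
    rw [ae_iff]
    simp only [not_lt]
    change expMeasure 1 (Set.Iic 0) = 0
    rw [expMeasure_Iic one_pos]; simp
  · by_cases hij : i = j
    · simp [hij]
    have hm : MeasurableSet {e | clock β u e i = clock β u e j} :=
      measurableSet_eq_fun (measurable_clock β u i) (measurable_clock β u j)
    have : clockLaw N {e | clock β u e i = clock β u e j} = 0 := by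
      rw [← map_update_clockLaw i, Measure.map_apply (measurable_update_pair i) hm,
        Measure.prod_apply_symm (measurable_update_pair i hm)]
      refine (lintegral_congr fun e => ?_).trans lintegral_zero
      refine measure_mono_null (t := {e j / rate β u j * rate β u i}) (fun x hx => ?_)
        (measure_singleton _)
      simp only [Set.mem_preimage, Set.mem_ofPred_eq, clock_eq, Function.update_self,
        Function.update_of_ne (Ne.symm hij)] at hx
      rw [Set.mem_singleton_iff, ← hx, div_mul_cancel₀ _ (rate_pos β u i).ne']
    rw [ae_iff]
    simpa [hij] using this

theorem firstRing_eq_iff {β : ℝ} {e : Fin N × ℤˣ → ℝ} (he : e ∈ goodClocks N β)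
    (u : PressureList N) (i : Fin N × ℤˣ) :
    firstRing β u e = i ↔ ∀ j, clock β u e i ≤ clock β u e j := by
  refine ⟨fun h j => h ▸ firstRing_le β u e j, fun h => ?_⟩
  by_contra hne
  exact he.2 u _ _ hne ((firstRing_le β u e i).antisymm (h _))

theorem clockLaw_pi_ite (i : Fin N × ℤˣ) (c : Fin N × ℤˣ → ℝ) (hc : ∀ j, 0 ≤ c j) :
    clockLaw N {e | ∀ j, j ≠ i → c j ≤ e j} =
      ENNReal.ofReal (Real.exp (-∑ j ∈ Finset.univ.erase i, c j)) := by
  classical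
  have : {e : Fin N × ℤˣ → ℝ | ∀ j, j ≠ i → c j ≤ e j} =
      Set.univ.pi fun j => if j = i then Set.univ else Set.Ici (c j) := by
    ext e
    simp only [Set.mem_ofPred_eq, Set.mem_pi, Set.mem_univ, true_imp_iff]
    refine forall_congr' fun j => ?_
    by_cases hj : j = i <;> simp [hj]
  rw [this, clockLaw, Measure.pi_pi, ← Finset.mul_prod_erase _ _ (Finset.mem_univ i), if_pos rfl,
    measure_univ, one_mul, ← Finset.sum_neg_distrib, Real.exp_sum,
    ENNReal.ofReal_prod_of_nonneg fun _ _ => (Real.exp_pos _).le]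
  refine Finset.prod_congr rfl fun j hj => ?_
  rw [if_neg (Finset.ne_of_mem_erase hj), expMeasure_Ici (hc j)]

/-- The pair which rings first and the time when it rings are independent; the time is exponential
of parameter `totalRate β u`. -/
theorem lintegral_firstRing (β : ℝ) (u : PressureList N) (i : Fin N × ℤˣ) {φ : ℝ → ENNReal}
    (hφ : Measurable φ) :
    ∫⁻ e, {e | firstRing β u e = i}.indicator (fun e => φ (clock β u e i)) e ∂clockLaw N =
      stepProb β u i * ∫⁻ s, φ s ∂expMeasure (totalRate β u) := by
  classical
  set r := rate β u i with hr
  have hr0 : 0 < r := rate_pos β u i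
  set A : Set (Fin N × ℤˣ → ℝ) := {e | ∀ j, clock β u e i ≤ clock β u e j} with hA
  have hAm : MeasurableSet A := by
    have : A = ⋂ j, {e | clock β u e i ≤ clock β u e j} := by ext; simp [hA]
    rw [this]
    exact MeasurableSet.iInter fun j =>
      measurableSet_le (measurable_clock β u i) (measurable_clock β u j)
  have hF : Measurable (A.indicator fun e => φ (clock β u e i)) :=
    (hφ.comp (measurable_clock β u i)).indicator hAm
  have h1 : ∫⁻ e, {e | firstRing β u e = i}.indicator (fun e => φ (clock β u e i)) e ∂clockLaw N =
      ∫⁻ e, A.indicator (fun e => φ (clock β u e i)) e ∂clockLaw N := by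
    refine lintegral_congr_ae ((ae_mem_goodClocks β).mono fun e he => ?_)
    have := firstRing_eq_iff he u i
    simp only [Set.indicator_apply, hA, Set.mem_ofPred_eq, this]
  -- given that the clock of `i` rings at time `x / r`, all the other ones have to ring later
  have h2 : ∀ x, 0 ≤ x → ∫⁻ e, A.indicator (fun e => φ (clock β u e i)) (Function.update e i x)
      ∂clockLaw N = φ (x / r) * ENNReal.ofReal
        (Real.exp (-∑ j ∈ Finset.univ.erase i, x / r * rate β u j)) := by
    intro x hx
    rw [← clockLaw_pi_ite i (fun j => x / r * rate β u j) fun j =>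
      mul_nonneg (div_nonneg hx hr0.le) (rate_pos β u j).le]
    have hm : MeasurableSet {e : Fin N × ℤˣ → ℝ | ∀ j, j ≠ i → x / r * rate β u j ≤ e j} := by
      have : {e : Fin N × ℤˣ → ℝ | ∀ j, j ≠ i → x / r * rate β u j ≤ e j} =
          ⋂ j, ⋂ (_ : j ≠ i), {e | x / r * rate β u j ≤ e j} := by ext; simp
      rw [this]
      exact MeasurableSet.iInter fun j => MeasurableSet.iInter fun _ =>
        measurableSet_le measurable_const (measurable_pi_apply j)
    rw [← setLIntegral_const, ← lintegral_indicator hm]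
    refine lintegral_congr fun e => ?_
    have hmem : Function.update e i x ∈ A ↔
        e ∈ {e : Fin N × ℤˣ → ℝ | ∀ j, j ≠ i → x / r * rate β u j ≤ e j} := by
      simp only [hA, Set.mem_ofPred_eq, clock_eq, Function.update_self]
      refine forall_congr' fun j => ?_
      by_cases hj : j = i
      · subst hj; simp
      · rw [Function.update_of_ne hj, le_div_iff₀ (rate_pos β u j)]; simp [hj, hr]
    simp only [Set.indicator_apply, hmem, clock_eq, Function.update_self]
    rfl
  have h3 : ∀ s, exponentialPDF 1 (r * s) * (φ s * ENNReal.ofReal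
      (Real.exp (-∑ j ∈ Finset.univ.erase i, s * rate β u j))) =
      ENNReal.ofReal r⁻¹ * (stepProb β u i * (exponentialPDF (totalRate β u) s * φ s)) := by
    intro s
    rcases lt_or_ge s 0 with hs | hs
    · rw [exponentialPDF_of_neg hs, exponentialPDF_of_neg (mul_neg_of_pos_of_neg hr0 hs)]; simp
    · rw [exponentialPDF_of_nonneg hs, exponentialPDF_of_nonneg (mul_nonneg hr0.le hs), stepProb]
      have hq := totalRate_pos β u
      have : ENNReal.ofReal (1 * Real.exp (-(1 * (r * s)))) * ENNReal.ofReal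
          (Real.exp (-∑ j ∈ Finset.univ.erase i, s * rate β u j)) =
          ENNReal.ofReal r⁻¹ * (ENNReal.ofReal (rate β u i / totalRate β u) *
            ENNReal.ofReal (totalRate β u * Real.exp (-(totalRate β u * s)))) := by
        rw [← ENNReal.ofReal_mul (by positivity), ← ENNReal.ofReal_mul (by positivity),
          ← ENNReal.ofReal_mul (by positivity), one_mul, one_mul, ← Real.exp_add]
        congr 1
        rw [← hr, ← Finset.mul_sum]
        have : totalRate β u = r + ∑ j ∈ Finset.univ.erase i, rate β u j :=
          (Finset.add_sum_erase _ _ (Finset.mem_univ i)).symm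
        field_simp
        congr 1
        rw [this]; ring
      rw [mul_left_comm, this]; ring
  rw [h1, lintegral_clockLaw_eq_update i hF]
  set G : ℝ → ENNReal := fun x => φ (x / r) * ENNReal.ofReal
    (Real.exp (-∑ j ∈ Finset.univ.erase i, x / r * rate β u j)) with hG
  have hGm : Measurable G := by
    refine (hφ.comp (measurable_id.div_const r)).mul (Measurable.ennreal_ofReal ?_)
    fun_prop
  have h4 : ∫⁻ x, ∫⁻ e, A.indicator (fun e => φ (clock β u e i)) (Function.update e i x)
      ∂clockLaw N ∂expMeasure 1 = ∫⁻ x, G x ∂expMeasure 1 := by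
    refine lintegral_congr_ae ?_
    have : ∀ᵐ x ∂expMeasure 1, 0 ≤ x := by
      rw [ae_iff]
      simp only [not_le]
      refine measure_mono_null (Set.Iio_subset_Iic_self : Set.Iio (0 : ℝ) ⊆ _) ?_
      rw [expMeasure_Iic one_pos]; simp
    exact this.mono fun x hx => h2 x hx
  have hPm : Measurable (exponentialPDF 1) := (measurable_exponentialPDFReal 1).ennreal_ofReal
  have hPq : Measurable (exponentialPDF (totalRate β u)) :=
    (measurable_exponentialPDFReal _).ennreal_ofReal
  rw [h4, lintegral_expMeasure 1 hGm, lintegral_expMeasure _ hφ]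
  -- the change of variables `x = r * s`
  have h5 : ∫⁻ s, exponentialPDF 1 (r * s) * G (r * s) =
      ENNReal.ofReal r⁻¹ * ∫⁻ x, exponentialPDF 1 x * G x := by
    rw [← lintegral_map (f := fun x => exponentialPDF 1 x * G x) (hPm.mul hGm)
      (measurable_const_mul r), Real.map_volume_mul_left hr0.ne', lintegral_smul_measure,
      abs_of_pos (inv_pos.2 hr0), smul_eq_mul]
  have h6 : ∀ s, exponentialPDF 1 (r * s) * G (r * s) =
      ENNReal.ofReal r⁻¹ * (stepProb β u i * (exponentialPDF (totalRate β u) s * φ s)) := by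
    intro s
    rw [← h3 s, hG]
    simp only [mul_div_cancel_left₀ s hr0.ne']
  simp only [h6] at h5
  have hPφ : Measurable fun s => exponentialPDF (totalRate β u) s * φ s := hPq.mul hφ
  rw [lintegral_const_mul _ (hPφ.const_mul _), lintegral_const_mul _ hPφ] at h5
  exact ((ENNReal.mul_right_inj (by simpa using hr0) ENNReal.ofReal_ne_top).1 h5).symm

/-! ### Decomposition of the process at its first jump -/

/-- The list after the first expressed opinion. -/
def nextList (β : ℝ) (u : PressureList N) (e : Fin N × ℤˣ → ℝ) : PressureList N :=
  express (firstRing β u e).1 (firstRing β u e).2 u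

/-- The time of the first expressed opinion. -/
def holdTime (β : ℝ) (u : PressureList N) (e : Fin N × ℤˣ → ℝ) : ℝ :=
  clock β u e (firstRing β u e)

theorem holdTime_pos {β : ℝ} {u : PressureList N} {e : Fin N × ℤˣ → ℝ} (he : ∀ i, 0 < e i) :
    0 < holdTime β u e := div_pos (he _) (Real.exp_pos _)

theorem chain_succ (β : ℝ) (u : PressureList N) (ω : Sample N) (n : ℕ) :
    chain β u ω (n + 1) = nextList β (chain β u ω n) (ω n) := rfl

theorem jumpTime_succ (β : ℝ) (u : PressureList N) (ω : Sample N) (n : ℕ) :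
    jumpTime β u ω (n + 1) = jumpTime β u ω n + holdTime β (chain β u ω n) (ω n) := rfl

theorem chain_succ' (β : ℝ) (u : PressureList N) (ω : Sample N) (n : ℕ) :
    chain β u ω (n + 1) = chain β (nextList β u (ω 0)) (fun k => ω (k + 1)) n := by
  induction n with
  | zero => rfl
  | succ n ih => rw [chain_succ, ih, chain_succ]

theorem jumpTime_succ' (β : ℝ) (u : PressureList N) (ω : Sample N) (n : ℕ) :
    jumpTime β u ω (n + 1) =
      holdTime β u (ω 0) + jumpTime β (nextList β u (ω 0)) (fun k => ω (k + 1)) n := by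
  induction n with
  | zero => rw [jumpTime_succ]; simp [jumpTime, chain]
  | succ n ih => rw [jumpTime_succ, ih, chain_succ', jumpTime_succ, add_assoc]

theorem jumpTime_strictMono {β : ℝ} {u : PressureList N} {ω : Sample N}
    (h : ∀ n i, 0 < ω n i) : StrictMono (jumpTime β u ω) :=
  strictMono_nat_of_lt_succ fun n => by
    rw [jumpTime_succ]; linarith [holdTime_pos (β := β) (u := chain β u ω n) (h n)]

/-- With positive clocks the jump times increase, so the index `m` which defines the process is
unique. -/
theorem process_eq_some_iff {β : ℝ} {u : PressureList N} {ω : Sample N} (h : ∀ n i, 0 < ω n i)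
    (t : ℝ) (v : PressureList N) : process β u ω t = some v ↔
      ∃ m, (jumpTime β u ω m ≤ t ∧ t < jumpTime β u ω (m + 1)) ∧ chain β u ω m = v := by
  classical
  have hT : StrictMono (jumpTime β u ω) := jumpTime_strictMono h
  have huniq : ∀ m m', jumpTime β u ω m ≤ t → t < jumpTime β u ω (m' + 1) → m ≤ m' :=
    fun m m' h1 h2 => Nat.lt_succ_iff.1 (hT.lt_iff_lt.1 (h1.trans_lt h2))
  unfold process
  split_ifs with hex
  · rw [Option.some_inj]
    refine ⟨fun hv => ⟨_, Nat.find_spec hex, hv⟩, ?_⟩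
    rintro ⟨m, ⟨h1, h2⟩, rfl⟩
    have h3 := Nat.find_spec hex
    rw [(huniq _ _ h3.1 h2).antisymm (huniq _ _ h1 h3.2)]
  · simp only [false_iff]
    exact fun ⟨m, hm, _⟩ => hex ⟨m, hm⟩

/-- The event that the process is in `B` at time `t`. -/
def occupation (β : ℝ) (u : PressureList N) (B : Set (PressureList N)) (t : ℝ) : Set (Sample N) :=
  {ω | ∃ v ∈ B, process β u ω t = some v}

theorem mem_occupation_iff {β : ℝ} {u : PressureList N} {B : Set (PressureList N)} {t : ℝ}
    {ω : Sample N} (h : ∀ n i, 0 < ω n i) : ω ∈ occupation β u B t ↔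
      ∃ m, (jumpTime β u ω m ≤ t ∧ t < jumpTime β u ω (m + 1)) ∧ chain β u ω m ∈ B := by
  simp only [occupation, Set.mem_ofPred_eq, process_eq_some_iff h]
  exact ⟨fun ⟨v, hv, m, hm, hc⟩ => ⟨m, hm, hc ▸ hv⟩, fun ⟨m, hm, hc⟩ => ⟨_, hc, m, hm, rfl⟩⟩

theorem notMem_occupation_of_neg {β : ℝ} {u : PressureList N} {B : Set (PressureList N)} {t : ℝ}
    (ht : t < 0) {ω : Sample N} (h : ∀ n i, 0 < ω n i) : ω ∉ occupation β u B t := by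
  rw [mem_occupation_iff h]
  rintro ⟨m, ⟨hm, -⟩, -⟩
  have : jumpTime β u ω 0 ≤ jumpTime β u ω m := (jumpTime_strictMono h).monotone (Nat.zero_le m)
  exact absurd (this.trans hm) (by simpa [jumpTime] using ht)

/-- Before the first jump the process is at `u`; after it, the process restarts from the new
list. -/
theorem consSample_mem_occupation_iff {β : ℝ} {u : PressureList N} {B : Set (PressureList N)}
    {t : ℝ} {e : Fin N × ℤˣ → ℝ} {ω : Sample N} (he : ∀ i, 0 < e i) (h : ∀ n i, 0 < ω n i) :
    consSample (e, ω) ∈ occupation β u B t ↔ ((0 ≤ t ∧ t < holdTime β u e) ∧ u ∈ B) ∨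
      ω ∈ occupation β (nextList β u e) B (t - holdTime β u e) := by
  have hc : ∀ n i, 0 < consSample (e, ω) n i := by
    intro n; cases n with
    | zero => exact he
    | succ n => exact h n
  rw [mem_occupation_iff hc, mem_occupation_iff h]
  have h1 : ∀ n, chain β u (consSample (e, ω)) (n + 1) = chain β (nextList β u e) ω n :=
    fun n => chain_succ' β u _ n
  have h2 : ∀ n, jumpTime β u (consSample (e, ω)) (n + 1) =
      holdTime β u e + jumpTime β (nextList β u e) ω n := fun n => jumpTime_succ' β u _ n
  constructor
  · rintro ⟨m, ⟨hm1, hm2⟩, hm3⟩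
    cases m with
    | zero => exact Or.inl ⟨⟨hm1, by rw [h2] at hm2; simpa [jumpTime] using hm2⟩, hm3⟩
    | succ m =>
      rw [h2] at hm1 hm2
      exact Or.inr ⟨m, ⟨by linarith, by linarith⟩, h1 m ▸ hm3⟩
  · rintro (⟨⟨hm1, hm2⟩, hm3⟩ | ⟨m, ⟨hm1, hm2⟩, hm3⟩)
    · exact ⟨0, ⟨hm1, by rw [h2]; simpa [jumpTime] using hm2⟩, hm3⟩
    · exact ⟨m + 1, ⟨by rw [h2]; linarith, by rw [h2]; linarith⟩, (h1 m).symm ▸ hm3⟩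

/-! ### Measurability -/

theorem goodClocks_nonempty (N : ℕ) (β : ℝ) : (goodClocks N β).Nonempty :=
  (ae_mem_goodClocks β).exists

open Classical in
/-- The identity on the good values, and some good value elsewhere. It makes the choice of the pair
which rings first measurable. -/
def clean (β : ℝ) (e : Fin N × ℤˣ → ℝ) : Fin N × ℤˣ → ℝ :=
  if e ∈ goodClocks N β then e else (goodClocks_nonempty N β).some

theorem clean_mem (β : ℝ) (e : Fin N × ℤˣ → ℝ) : clean β e ∈ goodClocks N β := by
  unfold clean
  split_ifs with h
  · exact h
  · exact (goodClocks_nonempty N β).some_mem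

theorem clean_of_mem {β : ℝ} {e : Fin N × ℤˣ → ℝ} (h : e ∈ goodClocks N β) : clean β e = e :=
  if_pos h

theorem measurable_clean (β : ℝ) : Measurable (clean (N := N) β) := by
  classical
  exact Measurable.ite (measurableSet_goodClocks β) measurable_id measurable_const

theorem measurableSet_firstRing_clean (β : ℝ) (u : PressureList N) (i : Fin N × ℤˣ) :
    MeasurableSet {e | firstRing β u (clean β e) = i} := by
  have : {e | firstRing β u (clean β e) = i} =
      ⋂ j, {e | clock β u (clean β e) i ≤ clock β u (clean β e) j} := by
    ext e; simp [firstRing_eq_iff (clean_mem β e)]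
  rw [this]
  exact MeasurableSet.iInter fun j => measurableSet_le
    ((measurable_clock β u i).comp (measurable_clean β))
    ((measurable_clock β u j).comp (measurable_clean β))

theorem measurable_nextList_clean (β : ℝ) (u : PressureList N) :
    Measurable fun e => nextList β u (clean β e) := by
  refine measurable_to_countable' fun v => ?_
  have : (fun e => nextList β u (clean β e)) ⁻¹' {v} =
      ⋃ i ∈ {i : Fin N × ℤˣ | express i.1 i.2 u = v}, {e | firstRing β u (clean β e) = i} := by
    ext e; simp [nextList]
  rw [this]
  exact MeasurableSet.biUnion (Set.to_countable _) fun i _ => measurableSet_firstRing_clean β u i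

theorem holdTime_eq_iInf (β : ℝ) (u : PressureList N) (e : Fin N × ℤˣ → ℝ) :
    holdTime β u e = ⨅ i, clock β u e i :=
  haveI := nonempty_pairs u
  le_antisymm (le_ciInf (firstRing_le β u e)) (ciInf_le (Set.finite_range _).bddBelow _)

theorem measurable_holdTime (β : ℝ) (u : PressureList N) : Measurable (holdTime β u) := by
  simp only [funext (holdTime_eq_iInf β u)]
  exact Measurable.iInf fun i => measurable_clock β u i

/-- The sample all of whose terms are made good. -/
def cleanSample (β : ℝ) (ω : Sample N) : Sample N := fun n => clean β (ω n)

theorem cleanSample_pos (β : ℝ) (ω : Sample N) (n : ℕ) (i : Fin N × ℤˣ) :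
    0 < cleanSample β ω n i := (clean_mem β (ω n)).1 i

theorem ae_cleanSample_eq (β : ℝ) : ∀ᵐ ω ∂prob N, cleanSample β ω = ω := by
  have : ∀ᵐ ω ∂prob N, ∀ n, ω n ∈ goodClocks N β := ae_all_iff.2 fun n =>
    (measurePreserving_eval_prob n).quasiMeasurePreserving.ae (ae_mem_goodClocks β)
  exact this.mono fun ω hω => funext fun n => clean_of_mem (hω n)

theorem measurable_chain_clean (β : ℝ) (u : PressureList N) (n : ℕ) :
    Measurable fun ω => chain β u (cleanSample β ω) n := by
  induction n with
  | zero => exact measurable_const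
  | succ n ih =>
    have h : Measurable fun p : PressureList N × (Fin N × ℤˣ → ℝ) =>
        nextList β p.1 (clean β p.2) :=
      measurable_from_prod_countable_right fun v => measurable_nextList_clean β v
    exact h.comp (ih.prodMk (measurable_pi_apply n))

theorem measurable_jumpTime_clean (β : ℝ) (u : PressureList N) (n : ℕ) :
    Measurable fun ω => jumpTime β u (cleanSample β ω) n := by
  induction n with
  | zero => exact measurable_const
  | succ n ih =>
    have h : Measurable fun p : PressureList N × (Fin N × ℤˣ → ℝ) =>
        holdTime β p.1 (clean β p.2) :=
      measurable_from_prod_countable_right fun v =>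
        (measurable_holdTime β v).comp (measurable_clean β)
    exact ih.add (h.comp ((measurable_chain_clean β u n).prodMk (measurable_pi_apply n)))

theorem measurableSet_occupation_clean (β : ℝ) (u : PressureList N) (B : Set (PressureList N)) :
    MeasurableSet {p : ℝ × Sample N | cleanSample β p.2 ∈ occupation β u B p.1} := by
  have : {p : ℝ × Sample N | cleanSample β p.2 ∈ occupation β u B p.1} =
      ⋃ m, ({p | jumpTime β u (cleanSample β p.2) m ≤ p.1} ∩
        {p | p.1 < jumpTime β u (cleanSample β p.2) (m + 1)}) ∩
        {p | chain β u (cleanSample β p.2) m ∈ B} := by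
    ext p
    simp [mem_occupation_iff (cleanSample_pos β p.2)]
  rw [this]
  refine MeasurableSet.iUnion fun m => ((measurableSet_le ?_ measurable_fst).inter
    (measurableSet_lt measurable_fst ?_)).inter ?_
  · exact (measurable_jumpTime_clean β u m).comp measurable_snd
  · exact (measurable_jumpTime_clean β u (m + 1)).comp measurable_snd
  · exact ((measurable_chain_clean β u m).comp measurable_snd) (MeasurableSet.of_discrete)

theorem transProb_eq (β t : ℝ) (u : PressureList N) (B : Set (PressureList N)) :
    transProb β t u B = prob N {ω | cleanSample β ω ∈ occupation β u B t} := by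
  refine measure_congr ((ae_cleanSample_eq β).mono fun ω hω => ?_)
  refine propext ?_
  change ω ∈ occupation β u B t ↔ cleanSample β ω ∈ occupation β u B t
  rw [hω]

theorem measurable_transProb (β : ℝ) (u : PressureList N) (B : Set (PressureList N)) :
    Measurable fun t => transProb β t u B := by
  simp only [transProb_eq]
  exact measurable_measure_prodMk_left (measurableSet_occupation_clean β u B)

theorem transProb_of_neg {β t : ℝ} (ht : t < 0) (u : PressureList N) (B : Set (PressureList N)) :
    transProb β t u B = 0 := by
  rw [transProb_eq]
  convert measure_empty (μ := prob N)
  exact Set.eq_empty_of_forall_notMem fun ω =>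
    notMem_occupation_of_neg ht (cleanSample_pos β ω)

theorem transProb_le_one (β t : ℝ) (u : PressureList N) (B : Set (PressureList N)) :
    transProb β t u B ≤ 1 := prob_le_one

theorem tsum_transProb_le_one (β t : ℝ) (u : PressureList N) :
    ∑' v, transProb β t u {v} ≤ 1 := by
  simp only [transProb_eq]
  rw [← measure_iUnion]
  · exact prob_le_one
  · intro v w hvw
    refine Set.disjoint_left.2 fun ω hv hw => hvw ?_
    obtain ⟨_, rfl, hv⟩ := hv
    obtain ⟨_, rfl, hw⟩ := hw
    exact Option.some_inj.1 (hv.symm.trans hw)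
  · exact fun v => measurable_prodMk_left (measurableSet_occupation_clean β u {v})

/-! ### The renewal equation and the invariance -/

theorem transProb_eq_lintegral (β t : ℝ) (u : PressureList N) (B : Set (PressureList N)) :
    transProb β t u B = ∫⁻ e, ({s | 0 ≤ t ∧ t < s}.indicator (fun _ => B.indicator 1 u)
      (holdTime β u e) + transProb β (t - holdTime β u e) (nextList β u e) B) ∂clockLaw N := by
  have hm : MeasurableSet {ω : Sample N | cleanSample β ω ∈ occupation β u B t} :=
    measurable_prodMk_left (measurableSet_occupation_clean β u B)
  rw [transProb_eq, ← map_consSample, Measure.map_apply measurable_consSample hm,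
    Measure.prod_apply (measurable_consSample hm)]
  refine lintegral_congr_ae ((ae_mem_goodClocks β).mono fun e he => ?_)
  have hcons : ∀ ω : Sample N,
      cleanSample β (consSample (e, ω)) = consSample (e, cleanSample β ω) := by
    intro ω; ext1 n
    cases n with
    | zero => exact clean_of_mem he
    | succ n => rfl
  have hset : Prod.mk e ⁻¹' (consSample ⁻¹' {ω | cleanSample β ω ∈ occupation β u B t}) =
      {ω | ((0 ≤ t ∧ t < holdTime β u e) ∧ u ∈ B) ∨
        cleanSample β ω ∈ occupation β (nextList β u e) B (t - holdTime β u e)} := by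
    ext ω
    simp only [Set.mem_preimage, Set.mem_ofPred_eq, hcons,
      consSample_mem_occupation_iff he.1 (cleanSample_pos β ω)]
  simp only [hset]
  by_cases hlt : 0 ≤ t ∧ t < holdTime β u e
  · rw [Set.indicator_of_mem (by exact hlt), transProb_of_neg (by linarith [hlt.2]), add_zero]
    by_cases hu : u ∈ B
    · simp [hlt, hu]
    · have : {ω : Sample N | ((0 ≤ t ∧ t < holdTime β u e) ∧ u ∈ B) ∨
          cleanSample β ω ∈ occupation β (nextList β u e) B (t - holdTime β u e)} = ∅ :=
        Set.eq_empty_of_forall_notMem fun ω hω => hω.elim (fun h => hu h.2)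
          (notMem_occupation_of_neg (by linarith [hlt.2]) (cleanSample_pos β ω))
      rw [this]; simp [hu]
  · rw [Set.indicator_of_notMem (by exact hlt), zero_add, transProb_eq]
    simp only [hlt, false_and, false_or]

/-- The function `t ↦ 1` on the nonnegative times. -/
def heaviside : ℝ → ENNReal := (Set.Ici 0).indicator 1

theorem measurable_heaviside : Measurable heaviside :=
  measurable_one.indicator measurableSet_Ici

theorem measurable_exponentialPDF (r : ℝ) : Measurable (exponentialPDF r) :=
  (measurable_exponentialPDFReal r).ennreal_ofReal

/-- The joint law of the pair which rings first and of the time when it rings. -/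
theorem lintegral_stepProb_split (β : ℝ) (u : PressureList N) (Φ : Fin N × ℤˣ → ℝ → ENNReal)
    (hΦ : ∀ i, Measurable (Φ i)) :
    ∫⁻ e, Φ (firstRing β u e) (holdTime β u e) ∂clockLaw N =
      ∫⁻ s, ∑ i, stepProb β u i * Φ i s ∂expMeasure (totalRate β u) := by
  classical
  rw [lintegral_finsetSum _ fun i _ => (hΦ i).const_mul _]
  simp only [lintegral_const_mul _ (hΦ _), ← lintegral_firstRing β u _ (hΦ _)]
  rw [← lintegral_finsetSum']
  · refine lintegral_congr fun e => ?_
    rw [Finset.sum_eq_single (firstRing β u e)]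
    · rw [Set.indicator_of_mem (by rfl)]; rfl
    · exact fun i _ hi => Set.indicator_of_notMem (fun h => hi h.symm) _
    · simp
  · intro i _
    have hm : MeasurableSet {e | ∀ j, clock β u e i ≤ clock β u e j} := by
      have : {e | ∀ j, clock β u e i ≤ clock β u e j} =
        ⋂ j, {e | clock β u e i ≤ clock β u e j} := by ext; simp
      rw [this]
      exact MeasurableSet.iInter fun j =>
        measurableSet_le (measurable_clock β u i) (measurable_clock β u j)
    refine ⟨_, ((hΦ i).comp (measurable_clock β u i)).indicator hm,
      (ae_mem_goodClocks β).mono fun e he => ?_⟩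
    have := firstRing_eq_iff he u i
    simp only [Set.indicator_apply, Set.mem_ofPred_eq, this]
    rfl

/-- The renewal equation: the first jump occurs after an exponential time, independent of the list
that follows it. -/
theorem transProb_renewal (β t : ℝ) (u : PressureList N) (B : Set (PressureList N)) :
    transProb β t u B = B.indicator 1 u * (exponentialPDF (totalRate β u) t /
        ENNReal.ofReal (totalRate β u)) +
      (exponentialPDF (totalRate β u) ⋆ₗ
        fun s => stepAvg β (fun w => transProb β s w B) u) t := by
  set q := totalRate β u with hq
  have hq0 : 0 < q := totalRate_pos β u
  have hS : MeasurableSet {s : ℝ | 0 ≤ t ∧ t < s} := by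
    by_cases ht : 0 ≤ t
    · simp only [ht, true_and]; exact measurableSet_Ioi
    · simp [ht]
  have hg : ∀ w, Measurable fun s => transProb β (t - s) w B := fun w =>
    (measurable_transProb β w B).comp (measurable_const.sub measurable_id)
  rw [transProb_eq_lintegral]
  refine (lintegral_stepProb_split β u (fun i s => {s | 0 ≤ t ∧ t < s}.indicator
    (fun _ => B.indicator 1 u) s + transProb β (t - s) (express i.1 i.2 u) B)
    fun i => (measurable_const.indicator hS).add (hg _)).trans ?_
  simp only [mul_add, Finset.sum_add_distrib, ← Finset.sum_mul, sum_stepProb, one_mul]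
  rw [lintegral_add_left (measurable_const.indicator hS), lintegral_indicator hS,
    setLIntegral_const]
  congr 1
  · congr 1
    by_cases ht : 0 ≤ t
    · rw [exponentialPDF_of_nonneg ht, ← ENNReal.ofReal_div_of_pos hq0,
        mul_div_cancel_left₀ _ hq0.ne', ← expMeasure_Ioi hq0 ht]
      congr 1; ext s; simp [ht]
    · rw [exponentialPDF_of_neg (not_le.1 ht)]; simp [ht]
  · rw [lintegral_expMeasure _ (Finset.measurable_sum _ fun i _ => (hg _).const_mul _),
      lconvolution_def]
    refine lintegral_congr fun s => ?_
    rw [stepAvg, neg_add_eq_sub]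

theorem exponentialPDF_lconvolution_heaviside {r : ℝ} (hr : 0 < r) (t : ℝ) :
    (exponentialPDF r ⋆ₗ heaviside) t =
      ENNReal.ofReal (if 0 ≤ t then 1 - Real.exp (-(r * t)) else 0) := by
  rw [← lintegral_exponentialPDF_eq_antiDeriv hr, lconvolution_def,
    ← lintegral_indicator measurableSet_Iic]
  refine lintegral_congr fun s => ?_
  by_cases hs : s ≤ t
  · rw [Set.indicator_of_mem (by exact hs), heaviside, Set.indicator_of_mem (by simpa using hs)]
    simp
  · rw [Set.indicator_of_notMem (by exact hs), heaviside,
      Set.indicator_of_notMem (by simpa using hs), mul_zero]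

theorem heaviside_eq {r : ℝ} (hr : 0 < r) (t : ℝ) : heaviside t =
    exponentialPDF r t / ENNReal.ofReal r + (exponentialPDF r ⋆ₗ heaviside) t := by
  rw [exponentialPDF_lconvolution_heaviside hr]
  by_cases ht : 0 ≤ t
  · have h1 : Real.exp (-(r * t)) ≤ 1 := by
      rw [Real.exp_le_one_iff]; have := mul_nonneg hr.le ht; linarith
    rw [exponentialPDF_of_nonneg ht, if_pos ht, ← ENNReal.ofReal_div_of_pos hr,
      mul_div_cancel_left₀ _ hr.ne', ← ENNReal.ofReal_add (Real.exp_pos _).le (by linarith),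
      heaviside, Set.indicator_of_mem (by exact ht)]
    simp
  · rw [exponentialPDF_of_neg (not_le.1 ht), if_neg ht, heaviside,
      Set.indicator_of_notMem (by exact ht)]
    simp

/-- The integrated backward equation, written without subtraction: convolving with `heaviside` is
integrating over the times before `t`. -/
theorem transProb_backward (β t : ℝ) (u : PressureList N) (B : Set (PressureList N)) :
    transProb β t u B + ENNReal.ofReal (totalRate β u) *
        (heaviside ⋆ₗ fun s => transProb β s u B) t =
      B.indicator 1 u * heaviside t + ENNReal.ofReal (totalRate β u) *
        (heaviside ⋆ₗ fun s => stepAvg β (fun w => transProb β s w B) u) t := by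
  set q := totalRate β u with hq
  have hq0 : 0 < q := totalRate_pos β u
  set D := exponentialPDF q with hD
  set g : ℝ → ENNReal := fun s => transProb β s u B with hg
  set k : ℝ → ENNReal := fun s => stepAvg β (fun w => transProb β s w B) u with hk
  set c : ENNReal := B.indicator 1 u with hc
  have hDm : Measurable D := measurable_exponentialPDF q
  have hHm := measurable_heaviside
  have hkm : Measurable k := Finset.measurable_sum _ fun i _ =>
    (measurable_transProb β _ B).const_mul _
  have hDkm : Measurable (D ⋆ₗ k) := measurable_lconvolution _ hDm hkm
  have hQ : ENNReal.ofReal q ≠ 0 := by simpa using hq0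
  have hg' : g = fun s => c * (D s / ENNReal.ofReal q) + (D ⋆ₗ k) s :=
    funext fun s => transProb_renewal β s u B
  -- convolution with `1` of the renewal equation
  have h1 : ENNReal.ofReal q * (heaviside ⋆ₗ g) t =
      c * (D ⋆ₗ heaviside) t + ENNReal.ofReal q * ((D ⋆ₗ heaviside) ⋆ₗ k) t := by
    rw [lconvolution_comm (f := D), ← lconvolution_assoc hHm hDm hkm, hg']
    simp only [lconvolution_def (f := heaviside) (g := fun s => c * (D s / ENNReal.ofReal q) +
      (D ⋆ₗ k) s), mul_add]
    have hm1 : Measurable fun y => heaviside y * D (-y + t) :=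
      hHm.mul (hDm.comp (measurable_neg.add_const t))
    have hm2 : Measurable fun y => heaviside y * (D ⋆ₗ k) (-y + t) :=
      hHm.mul (hDkm.comp (measurable_neg.add_const t))
    rw [lintegral_add_right _ hm2, mul_add]
    congr 1
    rw [lconvolution_def, ← lintegral_const_mul _ hm1, ← lintegral_const_mul']
    · refine lintegral_congr fun y => ?_
      rw [div_eq_mul_inv]
      calc _ = (ENNReal.ofReal q * (ENNReal.ofReal q)⁻¹) *
            (c * (heaviside y * D (-y + t))) := by ring
        _ = _ := by rw [ENNReal.mul_inv_cancel hQ ENNReal.ofReal_ne_top, one_mul]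
    · exact ENNReal.ofReal_ne_top
  -- `1` is the tail of the exponential law plus its distribution function
  have h2 : ENNReal.ofReal q * (heaviside ⋆ₗ k) t =
      (D ⋆ₗ k) t + ENNReal.ofReal q * ((D ⋆ₗ heaviside) ⋆ₗ k) t := by
    have hH : heaviside = fun s => D s / ENNReal.ofReal q + (D ⋆ₗ heaviside) s :=
      funext fun s => heaviside_eq hq0 s
    conv_lhs => rw [hH]
    simp only [lconvolution_def (g := k), add_mul]
    have hm2 : Measurable fun y => D y / ENNReal.ofReal q * k (-y + t) :=
      (hDm.div_const _).mul (hkm.comp (measurable_neg.add_const t))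
    rw [lintegral_add_left hm2, mul_add]
    congr 1
    rw [← lintegral_const_mul _ hm2]
    refine lintegral_congr fun y => ?_
    rw [← mul_assoc, ENNReal.mul_div_cancel hQ ENNReal.ofReal_ne_top]
  have h3 : transProb β t u B = c * (D t / ENNReal.ofReal q) + (D ⋆ₗ k) t :=
    transProb_renewal β t u B
  rw [h1, h2, h3, heaviside_eq hq0 t]
  ring

theorem heaviside_lconvolution_le {f : ℝ → ENNReal} (hf : ∀ s, f s ≤ 1)
    (hneg : ∀ s < 0, f s = 0) (t : ℝ) : (heaviside ⋆ₗ f) t ≤ ENNReal.ofReal t := by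
  rw [lconvolution_def]
  calc _ ≤ ∫⁻ y, (Set.Icc 0 t).indicator 1 y := by
        refine lintegral_mono fun y => ?_
        by_cases hy : y ∈ Set.Icc 0 t
        · rw [Set.indicator_of_mem hy]
          refine (mul_le_mul' (Set.indicator_le_self _ _ _) (hf _)).trans (by simp)
        · rw [Set.indicator_of_notMem hy]
          by_cases hy0 : 0 ≤ y
          · rw [hneg _ (by
              by_contra! h; exact hy ⟨hy0, by linarith⟩), mul_zero]
          · rw [heaviside, Set.indicator_of_notMem (by exact hy0), zero_mul]
    _ = ENNReal.ofReal t := by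
        rw [lintegral_indicator_one measurableSet_Icc, Real.volume_Icc, sub_zero]

/-- Dividing a stationary law of the embedded chain by the rates gives an invariant measure. -/
theorem tsum_timeDensity_mul_transProb {β t : ℝ} (ht : 0 ≤ t) {ν : PressureList N → ENNReal}
    (h1 : ∑' u, ν u = 1) (hν : IsStationary β ν) (B : Set (PressureList N)) :
    ∑' u, timeDensity β ν u * transProb β t u B = ∑' u, B.indicator (timeDensity β ν) u := by
  set G : PressureList N → ENNReal := fun w => (heaviside ⋆ₗ fun s => transProb β s w B) t with hG
  have hk : ∀ u, (heaviside ⋆ₗ fun s => stepAvg β (fun w => transProb β s w B) u) t =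
      stepAvg β G u := by
    intro u
    simp only [lconvolution_def, stepAvg, hG, Finset.mul_sum]
    have hm : ∀ w, Measurable fun y => heaviside y * transProb β (-y + t) w B := fun w =>
      measurable_heaviside.mul ((measurable_transProb β w B).comp (measurable_neg.add_const t))
    rw [lintegral_finsetSum]
    · refine Finset.sum_congr rfl fun i _ => ?_
      rw [← lintegral_const_mul _ (hm _)]
      exact lintegral_congr fun y => mul_left_comm _ _ _
    · intro i _
      simp only [mul_left_comm (heaviside _)]
      exact (hm _).const_mul _
  have hm : ∀ u, timeDensity β ν u * ENNReal.ofReal (totalRate β u) = ν u := fun u =>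
    ENNReal.div_mul_cancel (by simpa using totalRate_pos β u) ENNReal.ofReal_ne_top
  have hfin : ∑' u, ν u * G u ≠ ⊤ := by
    refine ((ENNReal.tsum_le_tsum fun u => mul_le_mul_right (heaviside_lconvolution_le
      (fun s => transProb_le_one β s u B) (fun s hs => transProb_of_neg hs u B) t) _).trans_lt
      ?_).ne
    rw [ENNReal.tsum_mul_right, h1, one_mul]
    exact ENNReal.ofReal_lt_top
  have hH : heaviside t = 1 := by rw [heaviside, Set.indicator_of_mem (by exact ht)]; rfl
  -- the integral terms of the backward equation, summed against `ν`, are equal and finite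
  refine (ENNReal.add_left_inj hfin).1 ?_
  calc _ = ∑' u, timeDensity β ν u * (transProb β t u B +
        ENNReal.ofReal (totalRate β u) * G u) := by
        rw [← ENNReal.tsum_add]
        refine tsum_congr fun u => ?_
        rw [mul_add, ← mul_assoc, hm]
    _ = ∑' u, timeDensity β ν u * (B.indicator 1 u +
        ENNReal.ofReal (totalRate β u) * stepAvg β G u) := by
        refine tsum_congr fun u => ?_
        have := transProb_backward β t u B
        rw [hk, hH, mul_one] at this
        rw [← this]
    _ = ∑' u, B.indicator (timeDensity β ν) u + ∑' u, ν u * stepAvg β G u := by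
        rw [← ENNReal.tsum_add]
        refine tsum_congr fun u => ?_
        rw [mul_add, ← mul_assoc, hm]
        congr 1
        by_cases hu : u ∈ B <;> simp [hu]
    _ = _ := by rw [hν G]

/-! ### Uniqueness of the invariant measure -/

theorem firstRing_eq_of_lt {β : ℝ} {u : PressureList N} {e : Fin N × ℤˣ → ℝ} {i : Fin N × ℤˣ}
    (h : ∀ j, j ≠ i → clock β u e i < clock β u e j) : firstRing β u e = i := by
  by_contra hne
  exact absurd (firstRing_le β u e i) (not_le.2 (h _ hne))

theorem exists_rate_eq_one (β : ℝ) (u : PressureList N) : ∃ i, rate β u i = 1 := by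
  obtain ⟨a, ha⟩ := u.2
  exact ⟨(a, 1), by simp [rate, ha]⟩

/-- If the variable of each pair of an easy path is small at its step, the other ones being larger
than `1`, then the process follows the path, quickly. -/
theorem EasyPath.chain_eq {β κ τ : ℝ} (hτ0 : 0 < τ) (hτ : τ ≤ 1) {u : PressureList N}
    {l : List (Fin N × ℤˣ)} (h : EasyPath β κ u l) {ω : Sample N}
    (hω : ∀ k (hk : k < l.length), ω k l[k] ≤ κ * τ ∧ ∀ j, j ≠ l[k] → 1 < ω k j) :
    chain β u ω l.length = run u l ∧ jumpTime β u ω l.length ≤ l.length * τ := by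
  induction l generalizing u ω with
  | nil => exact ⟨rfl, by simp [jumpTime]⟩
  | cons i l ih =>
    obtain ⟨h1, h2⟩ := hω 0 (by simp)
    simp only [List.getElem_cons_zero] at h1 h2
    have hri := rate_pos β u i
    have hfr : firstRing β u (ω 0) = i := by
      refine firstRing_eq_of_lt fun j hj => ?_
      have hrj := rate_pos β u j
      rw [clock_eq, clock_eq, div_lt_div_iff₀ hri hrj]
      calc ω 0 i * rate β u j ≤ κ * τ * rate β u j := mul_le_mul_of_nonneg_right h1 hrj.le
        _ = κ * rate β u j * τ := by ring
        _ ≤ rate β u i * τ := mul_le_mul_of_nonneg_right (h.1 j) hτ0.le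
        _ ≤ rate β u i * 1 := mul_le_mul_of_nonneg_left hτ hri.le
        _ < rate β u i * ω 0 j := mul_lt_mul_of_pos_left (h2 j hj) hri
        _ = ω 0 j * rate β u i := mul_comm _ _
    have hnext : nextList β u (ω 0) = express i.1 i.2 u := by rw [nextList, hfr]
    have hhold : holdTime β u (ω 0) ≤ τ := by
      rw [holdTime, hfr, clock_eq, div_le_iff₀ hri]
      obtain ⟨j, hj⟩ := exists_rate_eq_one β u
      have := h.1 j
      rw [hj, mul_one] at this
      calc ω 0 i ≤ κ * τ := h1
        _ ≤ rate β u i * τ := mul_le_mul_of_nonneg_right this hτ0.le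
        _ = τ * rate β u i := mul_comm _ _
    obtain ⟨ih1, ih2⟩ := ih h.2 (ω := fun k => ω (k + 1)) fun k hk =>
      hω (k + 1) (by simpa using hk)
    rw [List.length_cons, chain_succ', jumpTime_succ', hnext]
    refine ⟨ih1, ?_⟩
    push_cast
    linarith

/-- Some list is reached at time `1` with a probability bounded below uniformly in the starting
list. -/
theorem exists_le_transProb_one (hN : 1 ≤ N) {β : ℝ} (hβ : 0 ≤ β) :
    ∃ (v₀ : PressureList N) (ε : ENNReal), ε ≠ 0 ∧ ∀ u, ε ≤ transProb β 1 u {v₀} := by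
  classical
  obtain ⟨v₀, hv₀⟩ := exists_easyPath hN
  obtain ⟨κ, hκ, -, hpath⟩ := hv₀ β hβ
  set m := 2 * N with hm
  -- a bound on each holding time, such that `m` jumps take less than a unit of time
  set τ : ℝ := 1 / (m + 1) with hτ
  have hτ0 : 0 < τ := by positivity
  have hτ1 : τ ≤ 1 := by
    rw [hτ, div_le_one (by positivity)]; have : (0 : ℝ) ≤ m := Nat.cast_nonneg m; linarith
  have hmτ : m * τ ≤ 1 := by
    rw [hτ, mul_one_div, div_le_one (by positivity)]; linarith
  -- the steps of the path
  set A : Fin N × ℤˣ → Set (Fin N × ℤˣ → ℝ) := fun i =>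
    Set.univ.pi fun j => if j = i then Set.Iic (κ * τ) else Set.Ioi 1 with hA
  -- a long stay at the end of the path
  set A' : Set (Fin N × ℤˣ → ℝ) := Set.univ.pi fun _ => Set.Ioi (totalRate β v₀) with hA'
  set c : ENNReal := min (expMeasure 1 (Set.Iic (κ * τ))) (expMeasure 1 (Set.Ioi 1)) with hc
  have hc0 : c ≠ 0 := by
    refine (lt_min ?_ ?_).ne'
    · have : 0 < κ * τ := mul_pos hκ hτ0
      rw [expMeasure_Iic one_pos, if_pos this.le, ENNReal.ofReal_pos, sub_pos, Real.exp_lt_one_iff]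
      linarith
    · rw [expMeasure_Ioi one_pos zero_le_one, ENNReal.ofReal_pos]; exact Real.exp_pos _
  have hAc : ∀ i, c ^ (2 * N) ≤ clockLaw N (A i) := by
    intro i
    rw [clockLaw, hA, Measure.pi_pi, ← card_pairs, ← Finset.card_univ, ← Finset.prod_const]
    refine Finset.prod_le_prod' fun j _ => ?_
    split_ifs
    · exact min_le_left _ _
    · exact min_le_right _ _
  have hA'0 : clockLaw N A' ≠ 0 := by
    rw [clockLaw, hA', Measure.pi_pi]
    refine Finset.prod_ne_zero_iff.2 fun j _ => ?_
    rw [expMeasure_Ioi one_pos (totalRate_pos β v₀).le]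
    simpa using Real.exp_pos _
  set c' : ENNReal := min (c ^ (2 * N)) (clockLaw N A') with hc'
  have hc'0 : c' ≠ 0 :=
    (lt_min (pos_iff_ne_zero.2 (pow_ne_zero _ hc0)) (pos_iff_ne_zero.2 hA'0)).ne'
  refine ⟨v₀, c' ^ (m + 1), pow_ne_zero _ hc'0, fun u => ?_⟩
  obtain ⟨l, hl, hr, he⟩ := hpath u
  set t : ℕ → Set (Fin N × ℤˣ → ℝ) := fun k => if hk : k < l.length then A l[k] else A' with ht
  have htm : ∀ k, MeasurableSet (t k) := by
    intro k
    simp only [ht]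
    split_ifs
    · refine MeasurableSet.univ_pi fun j => ?_
      split_ifs
      · exact measurableSet_Iic
      · exact measurableSet_Ioi
    · exact MeasurableSet.univ_pi fun j => measurableSet_Ioi
  have htc : ∀ k, c' ≤ clockLaw N (t k) := by
    intro k
    simp only [ht]
    split_ifs
    · exact (min_le_left _ _).trans (hAc _)
    · exact min_le_right _ _
  calc c' ^ (m + 1) = ∏ k ∈ Finset.range (m + 1), c' := by simp
    _ ≤ ∏ k ∈ Finset.range (m + 1), clockLaw N (t k) := Finset.prod_le_prod' fun k _ => htc k
    _ = prob N (Set.pi (Finset.range (m + 1) : Set ℕ) t) := by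
      rw [prob_eq_infinitePi, Measure.infinitePi_pi _ fun k _ => htm k]
    _ ≤ transProb β 1 u {v₀} := by
      refine measure_mono_ae ((ae_cleanSample_eq β).mono fun ω hω hmem => ?_)
      have hpos : ∀ n i, 0 < ω n i := hω ▸ cleanSample_pos β ω
      have hmem' : ∀ k < m + 1, ω k ∈ t k := fun k hk => hmem k (by simpa using hk)
      obtain ⟨h1, h2⟩ := he.chain_eq hτ0 hτ1 (ω := ω) fun k hk => by
        have := hmem' k (by omega)
        simp only [ht, hk, dif_pos, hA, Set.mem_pi, Set.mem_univ, true_imp_iff] at this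
        exact ⟨by simpa using this l[k], fun j hj => by simpa [hj] using this j⟩
      rw [hl, hr] at h1
      rw [hl] at h2
      refine (mem_occupation_iff hpos).2 ⟨m, ⟨h2.trans hmτ, ?_⟩, h1⟩
      have h3 := hmem' m (by omega)
      simp only [ht, hl, lt_irrefl, dif_neg, not_false_eq_true, hA', Set.mem_pi, Set.mem_univ,
        true_imp_iff, Set.mem_Ioi] at h3
      have h4 : (0 : ℝ) ≤ jumpTime β u ω m := (jumpTime_strictMono hpos).monotone (Nat.zero_le m)
      rw [jumpTime_succ, h1, holdTime, clock_eq]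
      have h5 : 1 < ω m (firstRing β v₀ (ω m)) / rate β v₀ (firstRing β v₀ (ω m)) := by
        rw [one_lt_div (rate_pos _ _ _)]
        exact (rate_le_totalRate β v₀ _).trans_lt (h3 _)
      linarith

/-- A substochastic matrix with a column bounded below has at most one invariant law. The positive
part `d` of the difference of two such laws satisfies `d ≤ d P`; up to exchanging them `d` vanishes
at `v₀`, where `d P` is at least `ε` times the mass of `d`. -/
theorem eq_of_invariant {S : Type*} (P : S → S → ENNReal) (hP : ∀ u, ∑' v, P u v ≤ 1) (v₀ : S)
    {ε : ENNReal} (hε : ε ≠ 0) (h : ∀ u, ε ≤ P u v₀) {p q : S → ENNReal} (hp1 : ∑' u, p u = 1)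
    (hq1 : ∑' u, q u = 1) (hp : ∀ v, ∑' u, p u * P u v = p v) (hq : ∀ v, ∑' u, q u * P u v = q v) :
    p = q := by
  wlog hle : p v₀ ≤ q v₀ generalizing p q
  · exact (this hq1 hp1 hq hp (le_of_not_ge hle)).symm
  classical
  set d : S → ENNReal := fun u => p u - q u with hd
  have hdP : ∀ v, d v ≤ ∑' u, d u * P u v := by
    intro v
    rw [hd, tsub_le_iff_left, ← hp v, ← hq v, ← ENNReal.tsum_add]
    refine ENNReal.tsum_le_tsum fun u => ?_
    rw [← add_mul]
    exact mul_le_mul_left le_add_tsub _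
  have hdfin : ∑' u, d u ≠ ⊤ :=
    ((ENNReal.tsum_le_tsum fun u => tsub_le_self).trans_lt (hp1 ▸ ENNReal.one_lt_top)).ne
  have hd0 : d v₀ = 0 := tsub_eq_zero_of_le hle
  -- the mass `∑ d` loses at least the fraction `ε` in one step
  have key : ∑' u, d u + (∑' u, d u) * ε ≤ ∑' u, d u + 0 := by
    calc ∑' u, d u + (∑' u, d u) * ε
        = ∑' v, (d v + (Pi.single v₀ ((∑' u, d u) * ε) : S → ENNReal) v) := by
          rw [ENNReal.tsum_add, tsum_pi_single]
      _ ≤ ∑' v, ∑' u, d u * P u v := by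
          refine ENNReal.tsum_le_tsum fun v => ?_
          by_cases hv : v = v₀
          · subst hv
            rw [hd0, zero_add, Pi.single_eq_same, ← ENNReal.tsum_mul_right]
            exact ENNReal.tsum_le_tsum fun u => mul_le_mul_right (h u) _
          · rw [Pi.single_eq_of_ne hv, add_zero]; exact hdP v
      _ = ∑' u, d u * ∑' v, P u v := by
          rw [ENNReal.tsum_comm]; simp only [ENNReal.tsum_mul_left]
      _ ≤ ∑' u, d u + 0 := by
          rw [add_zero]
          exact ENNReal.tsum_le_tsum fun u => mul_le_of_le_one_right' (hP u)
  have h0 : (∑' u, d u) * ε = 0 := le_antisymm (ENNReal.le_of_add_le_add_left hdfin key) zero_le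
  have hpq : ∀ u, p u ≤ q u := fun u =>
    tsub_eq_zero_iff_le.1 (ENNReal.tsum_eq_zero.1 ((mul_eq_zero.1 h0).resolve_right hε) u)
  by_contra hne
  obtain ⟨v, hv⟩ := Function.ne_iff.1 hne
  have := ENNReal.tsum_lt_tsum (by rw [hp1]; exact ENNReal.one_ne_top) hpq
    (lt_of_le_of_ne (hpq v) hv)
  rw [hp1, hq1] at this
  exact lt_irrefl _ this

theorem IsInvariantProb.eq (hN : 1 ≤ N) {β : ℝ} (hβ : 0 ≤ β) {μ ν : Measure (PressureList N)}
    (hμ : IsInvariantProb β μ) (hν : IsInvariantProb β ν) : μ = ν := by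
  obtain ⟨v₀, ε, hε, h⟩ := exists_le_transProb_one hN hβ
  have h1 : ∀ {μ : Measure (PressureList N)}, IsInvariantProb β μ → ∑' u, μ {u} = 1 := by
    intro μ hμ
    have := hμ.1
    have h := lintegral_countable' (μ := μ) fun _ => 1
    simpa using h.symm
  have h2 : ∀ {μ : Measure (PressureList N)}, IsInvariantProb β μ →
      ∀ v, ∑' u, μ {u} * transProb β 1 u {v} = μ {v} := by
    intro μ hμ v
    rw [← hμ.2 1 zero_le_one {v}, lintegral_countable']
    exact tsum_congr fun u => mul_comm _ _
  refine Measure.ext_of_singleton fun v => ?_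
  exact congrFun (eq_of_invariant (fun u v => transProb β 1 u {v}) (tsum_transProb_le_one β 1) v₀ hε
    h (h1 hμ) (h1 hν) (h2 hμ) (h2 hν)) v

/-! ### Existence of the invariant measure -/

theorem tsum_timeDensity_le_one {β : ℝ} (hβ : 0 ≤ β) {ν : PressureList N → ENNReal}
    (h1 : ∑' u, ν u = 1) : ∑' u, timeDensity β ν u ≤ 1 := by
  rw [← h1]
  refine ENNReal.tsum_le_tsum fun u => ENNReal.div_le_of_le_mul ?_
  refine le_mul_of_one_le_right' ?_
  rw [ENNReal.one_le_ofReal]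
  exact (Real.one_le_exp (by positivity)).trans (exp_peak_le_totalRate β u)

theorem tsum_timeDensity_ne_zero {β : ℝ} {ν : PressureList N → ENNReal} (h1 : ∑' u, ν u = 1) :
    ∑' u, timeDensity β ν u ≠ 0 := by
  intro h
  have : ∀ u, ν u = 0 := fun u =>
    (ENNReal.div_eq_zero_iff.1 (ENNReal.tsum_eq_zero.1 h u)).resolve_right ENNReal.ofReal_ne_top
  simp [this] at h1

/-- The invariant probability measure associated to a stationary law of the embedded chain. -/
def invariantMeasure (β : ℝ) (ν : PressureList N → ENNReal) : Measure (PressureList N) :=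
  (∑' u, timeDensity β ν u)⁻¹ • Measure.count.withDensity (timeDensity β ν)

theorem invariantMeasure_apply (β : ℝ) (ν : PressureList N → ENNReal) (B : Set (PressureList N)) :
    invariantMeasure β ν B =
      (∑' u, timeDensity β ν u)⁻¹ * ∑' u, B.indicator (timeDensity β ν) u := by
  rw [invariantMeasure, Measure.smul_apply, smul_eq_mul,
    withDensity_apply _ MeasurableSet.of_discrete, ← lintegral_indicator MeasurableSet.of_discrete,
    lintegral_count]

theorem isInvariantProb_invariantMeasure {β : ℝ} (hβ : 0 ≤ β) {ν : PressureList N → ENNReal}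
    (h1 : ∑' u, ν u = 1) (hν : IsStationary β ν) : IsInvariantProb β (invariantMeasure β ν) := by
  classical
  refine ⟨⟨?_⟩, fun t ht B => ?_⟩
  · rw [invariantMeasure_apply, Set.indicator_univ]
    exact ENNReal.inv_mul_cancel (tsum_timeDensity_ne_zero h1)
      ((tsum_timeDensity_le_one hβ h1).trans_lt ENNReal.one_lt_top).ne
  · rw [lintegral_countable', invariantMeasure_apply,
      ← tsum_timeDensity_mul_transProb ht h1 hν B, ← ENNReal.tsum_mul_left]
    refine tsum_congr fun u => ?_
    have hs : ∑' v, ({u} : Set (PressureList N)).indicator (timeDensity β ν) v =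
        timeDensity β ν u := by
      rw [tsum_eq_single u fun v hv => Set.indicator_of_notMem (by simpa using hv) _]
      simp
    rw [invariantMeasure_apply, hs]
    ring

theorem existsUnique_isInvariantProb (hN : 1 ≤ N) {β : ℝ} (hβ : 0 ≤ β) :
    ∃! μ : Measure (PressureList N), IsInvariantProb β μ := by
  obtain ⟨ν, h1, hν⟩ := exists_isStationary hN hβ
  have h := isInvariantProb_invariantMeasure hβ h1 hν
  exact ⟨_, h, fun μ hμ => hμ.eq hN hβ h⟩

theorem exists_le_real_ladder (hN : 3 ≤ N) : ∃ C : ℝ, 0 < C ∧ ∀ β : ℝ, 0 ≤ β →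
    ∀ μ : Measure (PressureList N), IsInvariantProb β μ →
      1 - C * Real.exp (-β) ≤ μ.real (ladder N) := by
  obtain ⟨C, hC, h⟩ := exists_compl_le_mul_ladder hN
  refine ⟨C, hC, fun β hβ μ hμ => ?_⟩
  obtain ⟨ν, h1, hν⟩ := exists_isStationary (by omega : 1 ≤ N) hβ
  have hinv := isInvariantProb_invariantMeasure hβ h1 hν
  obtain rfl : μ = invariantMeasure β ν := hμ.eq (by omega) hβ hinv
  have := hμ.1
  have hle : invariantMeasure β ν (ladder N)ᶜ ≤ ENNReal.ofReal (C * Real.exp (-β)) := by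
    calc _ ≤ ENNReal.ofReal (C * Real.exp (-β)) * invariantMeasure β ν (ladder N) := by
          rw [invariantMeasure_apply, invariantMeasure_apply, mul_left_comm]
          exact mul_le_mul_right (h β hβ ν h1 hν) _
      _ ≤ _ := mul_le_of_le_one_right' prob_le_one
  have h2 : (invariantMeasure β ν).real (ladder N)ᶜ ≤ C * Real.exp (-β) :=
    ENNReal.toReal_le_of_le_ofReal (by positivity) hle
  rw [probReal_compl_eq_one_sub MeasurableSet.of_discrete] at h2
  linarith

/-! ### The time needed to reach the ladder lists -/

/-- A pair of positive cost cannot ring first if no exponential variable is smaller than the other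
ones by a factor `exp (-β)`. -/
theorem stepCost_firstRing_eq_zero {β : ℝ} (hβ : 0 ≤ β) (u : PressureList N)
    {e : Fin N × ℤˣ → ℝ} (he : ∀ i j, Real.exp (-β) * e j < e i) (hpos : ∀ i, 0 < e i) :
    stepCost u (firstRing β u e) = 0 := by
  set i := firstRing β u e with hi
  by_contra hne
  have h1 : 1 ≤ stepCost u i := by have := stepCost_nonneg u i; omega
  obtain ⟨j, hj⟩ := exists_stepCost_eq_zero u
  have h2 : rate β u i ≤ Real.exp (-β) * rate β u j := by
    rw [rate_eq, rate_eq, hj, ← Real.exp_add, Real.exp_le_exp]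
    have : (1 : ℝ) ≤ stepCost u i := by exact_mod_cast h1
    have := mul_le_mul_of_nonneg_left this hβ
    push_cast
    linarith
  have h3 := firstRing_le β u e j
  rw [← hi, clock_eq, clock_eq, div_le_div_iff₀ (rate_pos _ _ _) (rate_pos _ _ _)] at h3
  have h4 := mul_le_mul_of_nonneg_left h2 (hpos j).le
  have h5 := mul_lt_mul_of_pos_right (he i j) (rate_pos β u j)
  linarith

/-- As long as the exponential variables are comparable, the embedded chain follows a path of cost
zero, which avoids the null list, so that each holding time is at most `X * exp (-β)`. -/
theorem exists_run_eq_chain (hN : 3 ≤ N) {β X : ℝ} (hβ : 0 ≤ β) (hX : 0 ≤ X) {u : PressureList N}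
    (hu : u.1 ≠ 0) {ω : Sample N} (hpos : ∀ n i, 0 < ω n i) (n : ℕ)
    (hω : ∀ k < n, (∀ i j, Real.exp (-β) * ω k j < ω k i) ∧ ∀ i, ω k i ≤ X) :
    (∃ l : List (Fin N × ℤˣ), l.length = n ∧ pathCost u l = 0 ∧ chain β u ω n = run u l) ∧
      (chain β u ω n).1 ≠ 0 ∧ jumpTime β u ω n ≤ n * (X * Real.exp (-β)) := by
  induction n with
  | zero => exact ⟨⟨[], rfl, rfl, rfl⟩, hu, by simp [jumpTime]⟩
  | succ n ih =>
    obtain ⟨⟨l, hl, hc, hr⟩, h0, hT⟩ := ih fun k hk => hω k (by omega)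
    obtain ⟨h1, h2⟩ := hω n (by omega)
    set w := chain β u ω n with hw
    have hcost := stepCost_firstRing_eq_zero hβ w h1 (hpos n)
    refine ⟨⟨l ++ [firstRing β w (ω n)], by simp [hl], ?_, ?_⟩, ?_, ?_⟩
    · rw [pathCost_append, hc, ← hr]; simp [pathCost, hcost]
    · rw [run_append, ← hr]; rfl
    · intro hz
      have := (of_express_eq_zero hN hz).1
      rw [hcost] at this
      omega
    · have hp : 1 ≤ peak w := by
        by_contra! h
        exact h0 (eq_zero_of_peak_eq_zero (by omega))
      have hp' : (1 : ℝ) ≤ peak w := by exact_mod_cast hp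
      have hhold : holdTime β w (ω n) ≤ X * Real.exp (-β) := by
        rw [holdTime, clock_eq, rate_eq, hcost, Int.cast_zero, sub_zero, div_eq_mul_inv,
          ← Real.exp_neg]
        refine mul_le_mul (h2 _) (Real.exp_le_exp.2 ?_) (Real.exp_pos _).le hX
        have := mul_le_mul_of_nonneg_left hp' hβ
        linarith
      rw [jumpTime_succ, ← hw]
      push_cast
      linarith

theorem reachTime_le (hN : 3 ≤ N) {β X : ℝ} (hβ : 0 ≤ β) (hX : 0 ≤ X) {u : PressureList N}
    (hu : u.1 ≠ 0) {ω : Sample N} (hpos : ∀ n i, 0 < ω n i)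
    (hω : ∀ k < 3 * N, (∀ i j, Real.exp (-β) * ω k j < ω k i) ∧ ∀ i, ω k i ≤ X) :
    reachTime β u (ladder N) ω ≤ ENNReal.ofReal (3 * N * (X * Real.exp (-β))) := by
  obtain ⟨⟨l, hl, hc, hr⟩, -, hT⟩ := exists_run_eq_chain hN hβ hX hu hpos (3 * N) hω
  have hmono := jumpTime_strictMono (β := β) (u := u) hpos
  have h0 : 0 < jumpTime β u ω (3 * N) := hmono (show 0 < 3 * N by omega)
  refine le_trans (sInf_le ⟨jumpTime β u ω (3 * N), h0, ⟨_, ?_, (process_eq_some_iff hpos _ _).2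
    ⟨3 * N, ⟨le_rfl, hmono (Nat.lt_succ_self _)⟩, rfl⟩⟩, rfl⟩) (ENNReal.ofReal_le_ofReal ?_)
  · rw [hr]; exact run_mem_ladder (by omega) u l hl hc
  · simpa using hT

/-- An upper bound, uniform in the starting list, of the probability of reaching the ladder lists
late. -/
def lateBound (N : ℕ) (δ β : ℝ) : ENNReal :=
  ((3 * N * (2 * N) : ℕ) : ENNReal) * (ENNReal.ofReal (1 - Real.exp (-Real.exp (-β / 2))) +
    ENNReal.ofReal (Real.exp (-min (Real.exp (β / 2)) (Real.exp (β * δ) / (3 * N)))))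

theorem prob_lt_reachTime_le (hN : 3 ≤ N) {β : ℝ} (δ : ℝ) (hβ : 0 ≤ β) {u : PressureList N}
    (hu : u.1 ≠ 0) : prob N {ω | ENNReal.ofReal (Real.exp (-β * (1 - δ))) <
      reachTime β u (ladder N) ω} ≤ lateBound N δ β := by
  have hN0 : (0 : ℝ) < N := by exact_mod_cast (by omega : 0 < N)
  -- all the variables of the first `3 * N` steps lie in `(a, b]` up to a small probability
  set a := Real.exp (-β / 2) with ha
  set b := min (Real.exp (β / 2)) (Real.exp (β * δ) / (3 * N)) with hb
  have hb0 : 0 ≤ b := le_min (Real.exp_pos _).le (by positivity)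
  have hsub : {ω | ENNReal.ofReal (Real.exp (-β * (1 - δ))) < reachTime β u (ladder N) ω} ≤ᵐ[prob N]
      ⋃ k ∈ Finset.range (3 * N), ⋃ i ∈ (Finset.univ : Finset (Fin N × ℤˣ)),
        {ω : Sample N | ω k i ∈ Set.Iic a ∪ Set.Ioi b} := by
    refine (ae_cleanSample_eq β).mono fun ω hω hlt => ?_
    have hpos : ∀ n i, 0 < ω n i := hω ▸ cleanSample_pos β ω
    by_contra hnot
    have hall : ∀ k < 3 * N, ∀ i, a < ω k i ∧ ω k i ≤ b := by
      intro k hk i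
      by_contra hki
      refine hnot (Set.mem_biUnion (Finset.mem_coe.2 (Finset.mem_range.2 hk))
        (Set.mem_biUnion (Finset.mem_coe.2 (Finset.mem_univ i)) ?_))
      rw [not_and_or, not_lt, not_le] at hki
      exact hki
    have := reachTime_le hN hβ hb0 hu hpos fun k hk => ⟨fun i j => ?_, fun i => (hall k hk i).2⟩
    · refine absurd hlt (not_lt.2 (this.trans (ENNReal.ofReal_le_ofReal ?_)))
      calc 3 * N * (b * Real.exp (-β))
          ≤ 3 * N * (Real.exp (β * δ) / (3 * N) * Real.exp (-β)) := by
            gcongr; exact min_le_right _ _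
        _ = Real.exp (-β * (1 - δ)) := by
            rw [← mul_assoc, mul_div_cancel₀ _ (by positivity), ← Real.exp_add]; congr 1; ring
    · calc Real.exp (-β) * ω k j ≤ Real.exp (-β) * Real.exp (β / 2) :=
            mul_le_mul_of_nonneg_left ((hall k hk j).2.trans (min_le_left _ _)) (Real.exp_pos _).le
        _ = a := by rw [ha, ← Real.exp_add]; congr 1; ring
        _ < ω k i := (hall k hk i).1
  have hone : ∀ (k : ℕ) (i : Fin N × ℤˣ), prob N {ω : Sample N | ω k i ∈ Set.Iic a ∪ Set.Ioi b} ≤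
      ENNReal.ofReal (1 - Real.exp (-a)) + ENNReal.ofReal (Real.exp (-b)) := by
    intro k i
    have hmp := (measurePreserving_eval_clockLaw i).comp (measurePreserving_eval_prob (N := N) k)
    have := hmp.measure_preimage
      (measurableSet_Iic.union measurableSet_Ioi :
        MeasurableSet (Set.Iic a ∪ Set.Ioi b)).nullMeasurableSet
    refine (le_of_eq this).trans ((measure_union_le _ _).trans_eq ?_)
    rw [expMeasure_Iic one_pos, expMeasure_Ioi one_pos hb0, if_pos (Real.exp_pos _).le, one_mul,
      one_mul]
  refine (measure_mono_ae hsub).trans ((measure_biUnion_finset_le _ _).trans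
    ((Finset.sum_le_sum fun k _ => (measure_biUnion_finset_le _ _).trans
      (Finset.sum_le_sum fun i _ => hone k i)).trans_eq ?_))
  rw [Finset.sum_const, Finset.sum_const, Finset.card_range, Finset.card_univ, card_pairs,
    smul_smul, nsmul_eq_mul, lateBound]

theorem tendsto_lateBound (hN : 3 ≤ N) {δ : ℝ} (hδ : 0 < δ) :
    Tendsto (lateBound N δ) atTop (𝓝 0) := by
  have hN0 : (0 : ℝ) < N := by exact_mod_cast (by omega : 0 < N)
  have ha : Tendsto (fun β : ℝ => 1 - Real.exp (-Real.exp (-β / 2))) atTop (𝓝 0) := by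
    have h1 : Tendsto (fun β : ℝ => -β / 2) atTop atBot :=
      tendsto_neg_atTop_atBot.atBot_div_const two_pos
    have h2 := (Real.continuous_exp.tendsto (-0)).comp (Real.tendsto_exp_atBot.comp h1).neg
    simpa using h2.const_sub 1
  have hb : Tendsto (fun β : ℝ =>
      Real.exp (-min (Real.exp (β / 2)) (Real.exp (β * δ) / (3 * N)))) atTop (𝓝 0) := by
    refine Real.tendsto_exp_neg_atTop_nhds_zero.comp (tendsto_atTop_atTop.2 fun M => ?_)
    have h1 : Tendsto (fun β : ℝ => Real.exp (β / 2)) atTop atTop :=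
      Real.tendsto_exp_atTop.comp (tendsto_id.atTop_div_const two_pos)
    have h2 : Tendsto (fun β : ℝ => Real.exp (β * δ) / (3 * N)) atTop atTop :=
      (Real.tendsto_exp_atTop.comp (tendsto_id.atTop_mul_const hδ)).atTop_div_const (by positivity)
    obtain ⟨K, hK⟩ := eventually_atTop.1
      ((h1.eventually_ge_atTop M).and (h2.eventually_ge_atTop M))
    exact ⟨K, fun β hβ => le_min (hK β hβ).1 (hK β hβ).2⟩
  have h := (ENNReal.tendsto_ofReal ha).add (ENNReal.tendsto_ofReal hb)
  simp only [ENNReal.ofReal_zero, add_zero] at h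
  have := ENNReal.Tendsto.const_mul (a := ((3 * N * (2 * N) : ℕ) : ENNReal)) h
    (Or.inr (ENNReal.natCast_ne_top _))
  rw [mul_zero] at this
  exact this

end SocialNetwork

theorem theorem2 (N : ℕ) (hN : 3 ≤ N) :
    (∃ C : ℝ, 0 < C ∧ ∀ β : ℝ, 0 ≤ β →
      (∃! μ : Measure (SocialNetwork.PressureList N), SocialNetwork.IsInvariantProb β μ) ∧
      ∀ μ : Measure (SocialNetwork.PressureList N), SocialNetwork.IsInvariantProb β μ →
        1 - C * Real.exp (-β) ≤ μ.real (SocialNetwork.ladder N)) ∧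
    (∀ δ : ℝ, 0 < δ →
      Tendsto
        (fun β : ℝ => ⨆ u : {u : SocialNetwork.PressureList N // u.1 ≠ 0},
          SocialNetwork.prob N {ω | ENNReal.ofReal (Real.exp (-β * (1 - δ))) <
            SocialNetwork.reachTime β u.1 (SocialNetwork.ladder N) ω})
        atTop (𝓝 0)) := by
  refine ⟨?_, fun δ hδ => ?_⟩
  · obtain ⟨C, hC, h⟩ := SocialNetwork.exists_le_real_ladder hN
    exact ⟨C, hC, fun β hβ =>
      ⟨SocialNetwork.existsUnique_isInvariantProb (by omega) hβ, h β hβ⟩⟩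
  · refine tendsto_of_tendsto_of_tendsto_of_le_of_le' tendsto_const_nhds
      (SocialNetwork.tendsto_lateBound hN hδ) (Eventually.of_forall fun _ => zero_le) ?_
    filter_upwards [eventually_ge_atTop 0] with β hβ
    exact iSup_le fun u => SocialNetwork.prob_lt_reachTime_le hN δ hβ u.2

end
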